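/- **Setting.** Let every site of a ring host $n$ Majorana modes, with two sites per unit cell. Consider a brick-wall circuit of two-site Gaussian fermion channels (the 1D channel circuit corresponding to a staircase 2D sequential circuit), translation invariant by one unit cell in space and two steps in time: in odd steps a channel $N_1$ acts on the two sites of every cell, in even steps a channel $N_2$ acts on the second site of each cell and the first site of the next one. Each $N_i$ acts on real correlation matrices $\Gamma_{jl}=\frac i2\mathrm{Tr}(\rho[c_j,c_l])$ by $\Gamma\mapsto A_i+B_i\Gamma B_i^T$, where $A_i$ is a real antisymmetric and $B_i$ a real $2n\times 2n$ matrix, and the channel is completely positive and trace preserving, i.e. $\Lambda_i^T\Lambda_i\le I$ for $\Lambda_i=\begin{pmatrix}A_i&B_i\\-B_i^T&0\end{pmatrix}$. In the momentum sector $k$ one period (two steps) acts by $\mathcal N_k[\Gamma]=A_k+B_k\Gamma B_k^\dagger$ with $$B_k=(U_kB_2U_k^\dagger)B_1,\qquad A_k=U_kA_2U_k^\dagger+(U_kB_2U_k^\dagger)A_1(U_kB_2U_k^\dagger)^\dagger,\qquad U_k=\begin{pmatrix}0&I_n\\e^{ik}I_n&0\end{pmatrix}.$$ In the thermodynamic limit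 $k$ ranges over all of $\mathbb R/2\pi\mathbb Z$. Let $V_{k,u}\subset\mathbb C^{2n}$ be the span of the eigenvectors of $B_k$ with eigenvalue of modulus one (preserved modes) and $V_{k,d}=V_{k,u}^\perp$ (dissipative modes). Let $B_{k,d}$, $A_{k,d}$ be the blocks of $B_k$, $A_k$ on $V_{k,d}$, and let $$\Gamma^{(s)}_{k,d}=\sum_{s\ge0}B_{k,d}^{\,s}A_{k,d}(B_{k,d}^\dagger)^s,$$ an operator on $V_{k,d}$. The *bulk entanglement spectrum* at $k$ is the multiset $S(k)$ of the energies $\varepsilon=\log\frac{1+\lambda}{1-\lambda}\in[-\infty,+\infty]$, where $i\lambda$ runs through the eigenvalues of $\Gamma^{(s)}_{k,d}$ with multiplicity. **Theorem.** For every $n$ and all such $N_1,N_2$: 1. $\Gamma^{(s)}_{k,d}$ is well defined and is the steady state of the dissipative modes: for every $k\in\mathbb R$ and every initial $\Gamma_0$, the $V_{k,d}$-block of $\mathcal N_k^t[\Gamma_0]$ converges to $\Gamma^{(s)}_{k,d}$ as $t\to\infty$. On a ring of any number $L\ge1$ of cells, with any initial real matrix $\Gamma_0$, and for each $k=2\pi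 m/L$, $m\in\mathbb Z$, the $V_{k,d}$-block of the momentum-$k$ sector $\frac1L\sum_{x,y}e^{-ik(x-y)}\Gamma_{(x,\alpha),(y,\beta)}$ of the correlation matrix $\Gamma$ after $t$ periods of the real-space circuit converges to the same $\Gamma^{(s)}_{k,d}$. All eigenvalues of $\Gamma^{(s)}_{k,d}$ are of the form $i\lambda$ with $-1\le\lambda\le1$. 2. The bulk entanglement spectrum is continuous in momentum up to removable singularities: $S$ is $2\pi$-periodic, and there are a number $D$ and continuous $2\pi$-periodic functions $\varepsilon_1,\dots,\varepsilon_D:\mathbb R\to[-\infty,+\infty]$ such that $S(k)=\{\varepsilon_1(k),\dots,\varepsilon_D(k)\}$ as multisets for all but finitely many $k\in[0,2\pi)$. 3. The bulk entanglement spectrum is non-chiral: for every energy $E\in\mathbb R$, the numbers of upward and of downward crossings of $E$ balance. Precisely, for every $k_0\in\mathbb R$ there is an integer $c(k_0)$ such that, for all sufficiently small $\delta>0$, the number of levels in $(E,E+\delta)$ at momenta $k>k_0$ sufficiently close to $k_0$ minus the number at momenta $k<k_0$ sufficiently close to $k_0$ equals $c(k_0)$; only finitely many $k_0\in[0,2\pi)$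 have $c(k_0)\ne0$; and $\sum_{k_0\in[0,2\pi)}c(k_0)=0$. -/

import Mathlib

open Filter Topology

noncomputable section

/-- The Majorana modes of a unit cell: the `n` modes of its first site (`inl`) and the `n` modes
of its second site (`inr`). -/
abbrev CellMode (n : ℕ) : Type := Fin n ⊕ Fin n

/-- A Gaussian fermion channel on the Majorana modes `ι`.  It acts on correlation matrices
`Γ j l = (i/2) Tr (ρ [c j, c l])` by `Γ ↦ A + B Γ Bᵀ`, with `A` real antisymmetric and `B` real,
and is completely positive and trace preserving:
`Λᵀ Λ ≤ 1` for `Λ = (A, B; -Bᵀ, 0)`. -/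
structure GaussianChannel (ι : Type) [Fintype ι] [DecidableEq ι] where
  /-- the noise -/
  A : Matrix ι ι ℝ
  /-- the transfer matrix -/
  B : Matrix ι ι ℝ
  antisymm : A.transpose = -A
  cptp : (1 - (Matrix.fromBlocks A B (-B.transpose) 0).transpose *
    Matrix.fromBlocks A B (-B.transpose) 0).PosSemidef

/-! ### The brick-wall circuit on a ring of `L` unit cells -/

/-- The layer of two-site blocks `M`, one on the two sites of each unit cell. -/
def oddLayer {n : ℕ} (L : ℕ) (M : Matrix (CellMode n) (CellMode n) ℝ) :
    Matrix (ZMod L × CellMode n) (ZMod L × CellMode n) ℝ :=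
  fun p q => if p.1 = q.1 then M p.2 q.2 else 0

/-- Translation of the ring by one site (half a unit cell): the first site of cell `x` goes to the
second site of cell `x`, which goes to the first site of cell `x + 1`. -/
def siteShift (L n : ℕ) : ZMod L × CellMode n ≃ ZMod L × CellMode n where
  toFun p := match p with
    | (x, Sum.inl j) => (x, Sum.inr j)
    | (x, Sum.inr j) => (x + 1, Sum.inl j)
  invFun p := match p with
    | (x, Sum.inl j) => (x - 1, Sum.inr j)
    | (x, Sum.inr j) => (x, Sum.inl j)
  left_inv := by rintro ⟨x, j | j⟩ <;> simp
  right_inv := by rintro ⟨x, j | j⟩ <;> simp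

/-- The layer of two-site blocks `M`, one on the second site of each cell `x` and the first site of
the cell `x + 1`: the odd layer translated by one site. -/
def evenLayer {n : ℕ} (L : ℕ) (M : Matrix (CellMode n) (CellMode n) ℝ) :
    Matrix (ZMod L × CellMode n) (ZMod L × CellMode n) ℝ :=
  (oddLayer L M).submatrix (siteShift L n).symm (siteShift L n).symm

/-- One period (two time steps) of the circuit acting on the correlation matrix of the ring: all
gates `N₁` within the cells, then all gates `N₂` between neighbouring cells. -/
def ringPeriod {n : ℕ} (L : ℕ) [NeZero L] (N₁ N₂ : GaussianChannel (CellMode n))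
    (Γ : Matrix (ZMod L × CellMode n) (ZMod L × CellMode n) ℝ) :
    Matrix (ZMod L × CellMode n) (ZMod L × CellMode n) ℝ :=
  evenLayer L N₂.A + evenLayer L N₂.B *
    (oddLayer L N₁.A + oddLayer L N₁.B * Γ * (oddLayer L N₁.B).transpose) *
      (evenLayer L N₂.B).transpose

/-- The correlation matrix in the momentum sector `k`,
`Γ_k a b = (i/2) Tr (ρ [c_{a,k}, c_{b,-k}])` with `c_{a,k} = L^{-1/2} ∑ x, e^{-ikx} c_{a,x}`. -/
def momentumBlock {n : ℕ} (L : ℕ) [NeZero L] (k : ℝ)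
    (Γ : Matrix (ZMod L × CellMode n) (ZMod L × CellMode n) ℝ) :
    Matrix (CellMode n) (CellMode n) ℂ :=
  fun a b => (1 / (L : ℂ)) * ∑ x : ZMod L, ∑ y : ZMod L,
    Complex.exp (-Complex.I * k * ((x.val : ℂ) - (y.val : ℂ))) * (Γ (x, a) (y, b) : ℂ)

/-! ### The circuit in momentum space -/

/-- A real matrix read as a complex one. -/
def complexify {ι : Type} (M : Matrix ι ι ℝ) : Matrix ι ι ℂ := M.map (fun r => (r : ℂ))

/-- Translation by one site at momentum `k`. -/
def shiftSymbol (n : ℕ) (k : ℝ) : Matrix (CellMode n) (CellMode n) ℂ :=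
  Matrix.fromBlocks 0 1 (Complex.exp (Complex.I * k) • (1 : Matrix (Fin n) (Fin n) ℂ)) 0

/-- The layer of blocks `M` between neighbouring cells at momentum `k`. -/
def evenSymbol {n : ℕ} (M : Matrix (CellMode n) (CellMode n) ℝ) (k : ℝ) :
    Matrix (CellMode n) (CellMode n) ℂ :=
  shiftSymbol n k * complexify M * (shiftSymbol n k).conjTranspose

/-- `B_k` for one period of the circuit. -/
def periodB {n : ℕ} (N₁ N₂ : GaussianChannel (CellMode n)) (k : ℝ) :
    Matrix (CellMode n) (CellMode n) ℂ :=
  evenSymbol N₂.B k * complexify N₁.B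

/-- `A_k` for one period of the circuit. -/
def periodA {n : ℕ} (N₁ N₂ : GaussianChannel (CellMode n)) (k : ℝ) :
    Matrix (CellMode n) (CellMode n) ℂ :=
  evenSymbol N₂.A k +
    evenSymbol N₂.B k * complexify N₁.A * (evenSymbol N₂.B k).conjTranspose

/-- One period of the circuit at momentum `k`: `Γ_k ↦ A_k + B_k Γ_k B_k†`. -/
def momentumPeriod {n : ℕ} (N₁ N₂ : GaussianChannel (CellMode n)) (k : ℝ)
    (Γ : Matrix (CellMode n) (CellMode n) ℂ) : Matrix (CellMode n) (CellMode n) ℂ :=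
  periodA N₁ N₂ k + periodB N₁ N₂ k * Γ * (periodB N₁ N₂ k).conjTranspose

/-! ### Preserved and dissipative modes, steady state, bulk entanglement spectrum -/

/-- The preserved modes of `B`: the span of its eigenvectors with eigenvalue of modulus one. -/
def preservedModes {ι : Type} [Fintype ι] [DecidableEq ι] (B : Matrix ι ι ℂ) :
    Submodule ℂ (EuclideanSpace ℂ ι) :=
  Submodule.span ℂ {v | ∃ b : ℂ, ‖b‖ = 1 ∧ Matrix.toEuclideanCLM (𝕜 := ℂ) B v = b • v}

/-- The dissipative modes: the orthogonal complement of the preserved modes. -/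
def dissipativeModes {ι : Type} [Fintype ι] [DecidableEq ι] (B : Matrix ι ι ℂ) :
    Submodule ℂ (EuclideanSpace ℂ ι) :=
  (preservedModes B).orthogonal

/-- The diagonal block of the matrix `M` on the subspace `K`. -/
def blockOn {ι : Type} [Fintype ι] [DecidableEq ι] (K : Submodule ℂ (EuclideanSpace ℂ ι))
    (M : Matrix ι ι ℂ) : K →L[ℂ] K :=
  K.orthogonalProjectionOnto ∘L (Matrix.toEuclideanCLM (𝕜 := ℂ) M) ∘L K.subtypeL

/-- The dissipative modes at momentum `k`. -/
def dissipativeSector {n : ℕ} (N₁ N₂ : GaussianChannel (CellMode n)) (k : ℝ) :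
    Submodule ℂ (EuclideanSpace ℂ (CellMode n)) :=
  dissipativeModes (periodB N₁ N₂ k)

/-- The steady-state correlation matrix of the dissipative modes at momentum `k`,
`∑ s, B_d ^ s A_d (B_d†) ^ s`, as an operator on the space of these modes. -/
def steadyCorrelation {n : ℕ} (N₁ N₂ : GaussianChannel (CellMode n)) (k : ℝ) :
    dissipativeSector N₁ N₂ k →L[ℂ] dissipativeSector N₁ N₂ k :=
  ∑' s : ℕ, blockOn (dissipativeSector N₁ N₂ k) (periodB N₁ N₂ k) ^ s *
    blockOn (dissipativeSector N₁ N₂ k) (periodA N₁ N₂ k) *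
      blockOn (dissipativeSector N₁ N₂ k) (periodB N₁ N₂ k).conjTranspose ^ s

/-- The eigenvalues of the steady-state correlation matrix of the dissipative modes, with
multiplicity. -/
def steadyEigenvalues {n : ℕ} (N₁ N₂ : GaussianChannel (CellMode n)) (k : ℝ) : Multiset ℂ :=
  (LinearMap.charpoly
    (steadyCorrelation N₁ N₂ k :
      dissipativeSector N₁ N₂ k →ₗ[ℂ] dissipativeSector N₁ N₂ k)).roots

/-- The entanglement energy `log ((1 + l) / (1 - l))` for `-1 ≤ l ≤ 1`, equal to `+∞` at `l = 1`
and to `-∞` at `l = -1`. -/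
def entanglementEnergy (l : ℝ) : EReal :=
  ENNReal.log (ENNReal.ofReal (1 + l) / ENNReal.ofReal (1 - l))

/-- The bulk entanglement spectrum at momentum `k`, with multiplicity: the energies
`log ((1 + l) / (1 - l))` for the eigenvalues `i l` of the steady-state correlation matrix of the
dissipative modes. -/
def bulkEntanglementSpectrum {n : ℕ} (N₁ N₂ : GaussianChannel (CellMode n)) (k : ℝ) :
    Multiset EReal :=
  (steadyEigenvalues N₁ N₂ k).map (fun z => entanglementEnergy z.im)

/-! ### Continuity and chirality of a momentum-dependent spectrum -/

/-- A spectrum over the Brillouin zone is continuous up to removable singularities: except at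
finitely many momenta of the Brillouin zone it consists of the values of a fixed finite number of
bands that are continuous on the whole Brillouin zone (a circle), the values `±∞` being allowed. -/
def ContinuousUpToRemovable (S : ℝ → Multiset EReal) : Prop :=
  Function.Periodic S (2 * Real.pi) ∧
  ∃ (D : ℕ) (ε : Fin D → ℝ → EReal),
    (∀ j, Continuous (ε j)) ∧ (∀ j, Function.Periodic (ε j) (2 * Real.pi)) ∧
    {k ∈ Set.Ico 0 (2 * Real.pi) | S k ≠ Finset.univ.val.map (fun j => ε j k)}.Finite

open Classical in
/-- The number of levels of the spectrum strictly between `a` and `b`. -/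
def levelCount (T : Multiset EReal) (a b : ℝ) : ℕ :=
  Multiset.card (T.filter (fun e => (a : EReal) < e ∧ e < (b : EReal)))

/-- As the momentum increases through `k₀`, the net number of levels that pass continuously from
below to above the energy `E` is `c`: this is the increase of the number of levels in a sufficiently
small window above `E`.  Levels that jump across `E` by a finite or infinite amount are not
counted. -/
def HasFlowAt (S : ℝ → Multiset EReal) (E k₀ : ℝ) (c : ℤ) : Prop :=
  ∀ᶠ δ in 𝓝[>] (0 : ℝ), ∀ᶠ k in 𝓝[>] k₀, ∀ᶠ k' in 𝓝[<] k₀,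
    (levelCount (S k) E (E + δ) : ℤ) - (levelCount (S k') E (E + δ) : ℤ) = c

/-- A spectrum over the Brillouin zone is non-chiral: at every energy, the number of chiral modes
minus the number of antichiral modes, that is, of upward minus downward crossings as the momentum
traverses the Brillouin zone once, is well defined and vanishes. -/
def IsNonChiral (S : ℝ → Multiset EReal) : Prop :=
  ∀ E : ℝ, ∃ c : ℝ → ℤ, (∀ k₀, HasFlowAt S E k₀ (c k₀)) ∧
    {k₀ ∈ Set.Ico 0 (2 * Real.pi) | c k₀ ≠ 0}.Finite ∧
    ∑ᶠ k₀ ∈ Set.Ico 0 (2 * Real.pi), c k₀ = 0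

end

/-!
For each momentum `k` one period of the circuit is an affine map `Γ ↦ A_k + B_k Γ B_k†` with
`1 - B_k B_k† ± i A_k ≥ 0` (`isMatrixChannel_period`): this is the Schur complement of `Λ† Λ ≤ 1`,
and it survives composition.  In particular `B_k` is a contraction, so the span of its unimodular
eigenvectors is invariant under `B_k` and `B_k†` and the noise `A_k` vanishes there; on the
orthogonal complement the powers of `B_k` are summable by Gelfand's formula.  Hence the steady state
`Γ` exists and attracts every initial state, and summing the positivity condition gives
`1 ± i Γ ≥ 0`.  On a ring, plane waves intertwine the layers of the circuit with their symbols
(`momentumBlock_ringPeriod`), which reduces the dynamics to the sectors of fixed momentum.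

For the dependence on `k`, the steady state is replaced by the operator `3 - i Γ` on the dissipative
modes, extended by zero to the preserved modes.  Its spectrum lies in `{0} ∪ [2, 4]`, and it is the
limit at `r = 1` of the solutions of `G = C + r B_k G B_k†`, where `C = 3 (1 - B_k B_k†) - i A_k`.
By Cramer's rule, over polynomials in `1 - r` whose coefficients are periodic analytic functions of
`k`, it is a quotient of periodic analytic functions (`exists_common_denominator`); the dimension of
the space of preserved modes may jump, but it does not enter.  Being bounded, the quotient has only
removable singularities, so the family of operators agrees off finitely many momenta with an
analytic family of Hermitian matrices on the whole Brillouin zone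
(`exists_analytic_shiftedSteady`).

By Weyl's inequality the ordered eigenvalues of that family are continuous and periodic.  None of
them can leave `[2, 4]`, so those in `[2, 4]` are the bands (`exists_bands`).  The characteristic
polynomial has analytic coefficients, so a given level is an eigenvalue of the same multiplicity
at all but finitely many momenta; between these the number of bands above the level is constant.
The flow through the level at `k₀` is the jump of this number, and the jumps of a periodic step
function over a period cancel (`sum_jumps_eq_zero`).
-/

/-! ### Contractions with an invariant complement of unimodular eigenvectors -/

section Compression

open ContinuousLinearMap

variable {E : Type*} [NormedAddCommGroup E] [InnerProductSpace ℂ E]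

/-- The span of the eigenvectors with eigenvalue of modulus one. -/
def unimodularSpan (T : E →L[ℂ] E) : Submodule ℂ E :=
  Submodule.span ℂ {v | ∃ b : ℂ, ‖b‖ = 1 ∧ T v = b • v}

theorem apply_mem_unimodularSpan {T : E →L[ℂ] E} {u : E} (hu : u ∈ unimodularSpan T) :
    T u ∈ unimodularSpan T := by
  induction hu using Submodule.span_induction with
  | mem x hx =>
    obtain ⟨b, hb, hv⟩ := hx
    rw [hv]
    exact Submodule.smul_mem _ _ (Submodule.subset_span ⟨b, hb, hv⟩)
  | zero => simp
  | add x y _ _ hx hy => rw [map_add]; exact Submodule.add_mem _ hx hy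
  | smul a x _ hx => rw [map_smul]; exact Submodule.smul_mem _ _ hx

variable [FiniteDimensional ℂ E]

/-- The compression of an operator to a subspace: its diagonal block on that subspace. -/
noncomputable def compression (K : Submodule ℂ E) (T : E →L[ℂ] E) : K →L[ℂ] K :=
  K.orthogonalProjectionOnto ∘L T ∘L K.subtypeL

theorem star_apply_of_unimodular {T : E →L[ℂ] E} (hT : ‖T‖ ≤ 1) {b : ℂ} (hb : ‖b‖ = 1) {v : E}
    (hv : T v = b • v) : star T v = (starRingEnd ℂ b) • v := by
  have h1 : ‖star T v‖ ≤ ‖v‖ := by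
    calc ‖star T v‖ ≤ ‖star T‖ * ‖v‖ := (star T).le_opNorm v
      _ ≤ 1 * ‖v‖ := by gcongr; exact (adjoint.norm_map T).trans_le hT
      _ = ‖v‖ := one_mul _
  have h2 : RCLike.re (inner ℂ (star T v) ((starRingEnd ℂ b) • v)) = ‖v‖ ^ 2 := by
    rw [star_eq_adjoint, adjoint_inner_left, map_smul, hv, smul_smul, RCLike.conj_mul, hb]
    simp [← inner_self_eq_norm_sq (𝕜 := ℂ)]
  have h3 : ‖star T v - (starRingEnd ℂ b) • v‖ ^ 2 ≤ 0 := by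
    rw [@norm_sub_sq ℂ, h2, norm_smul, RCLike.norm_conj, hb, one_mul]
    nlinarith [norm_nonneg (star T v), norm_nonneg v]
  rw [← sub_eq_zero, ← norm_eq_zero]
  exact pow_eq_zero_iff (two_ne_zero) |>.1 (le_antisymm h3 (sq_nonneg _))

theorem star_apply_mem_unimodularSpan {T : E →L[ℂ] E} (hT : ‖T‖ ≤ 1) {u : E}
    (hu : u ∈ unimodularSpan T) : star T u ∈ unimodularSpan T := by
  induction hu using Submodule.span_induction with
  | mem x hx =>
    obtain ⟨b, hb, hv⟩ := hx
    rw [star_apply_of_unimodular hT hb hv]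
    exact Submodule.smul_mem _ _ (Submodule.subset_span ⟨b, hb, hv⟩)
  | zero => simp
  | add x y _ _ hx hy => rw [map_add]; exact Submodule.add_mem _ hx hy
  | smul a x _ hx => rw [map_smul]; exact Submodule.smul_mem _ _ hx

theorem apply_star_apply_of_mem_unimodularSpan {T : E →L[ℂ] E} (hT : ‖T‖ ≤ 1) {u : E}
    (hu : u ∈ unimodularSpan T) : T (star T u) = u := by
  induction hu using Submodule.span_induction with
  | mem x hx =>
    obtain ⟨b, hb, hv⟩ := hx
    rw [star_apply_of_unimodular hT hb hv, map_smul, hv, smul_smul, RCLike.conj_mul, hb]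
    simp
  | zero => simp
  | add x y _ _ hx hy => rw [map_add, map_add, hx, hy]
  | smul a x _ hx => rw [map_smul, map_smul, hx]

theorem apply_mem_orthogonal_of_star {T : E →L[ℂ] E} {U : Submodule ℂ E}
    (h : ∀ u ∈ U, star T u ∈ U) {x : E} (hx : x ∈ U.orthogonal) : T x ∈ U.orthogonal := by
  intro u hu
  rw [← adjoint_inner_left]
  exact hx _ (h u hu)

theorem subtypeL_comp_compression {K : Submodule ℂ E} {T : E →L[ℂ] E}
    (h : ∀ x ∈ K, T x ∈ K) : T ∘L K.subtypeL = K.subtypeL ∘L compression K T := by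
  ext x
  exact (K.starProjection_eq_self_iff.2 (h x x.2)).symm

theorem compression_star (K : Submodule ℂ E) (T : E →L[ℂ] E) :
    compression K (star T) = star (compression K T) := by
  simp only [compression, star_eq_adjoint, adjoint_comp, Submodule.adjoint_orthogonalProjectionOnto,
    Submodule.adjoint_subtypeL, comp_assoc]

theorem compression_comp_orthogonalProjectionOnto {K : Submodule ℂ E} {T : E →L[ℂ] E}
    (h : ∀ x ∈ K, star T x ∈ K) :
    K.orthogonalProjectionOnto ∘L T = compression K T ∘L K.orthogonalProjectionOnto := by
  have := congrArg adjoint (subtypeL_comp_compression h)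
  rw [adjoint_comp, adjoint_comp, Submodule.adjoint_subtypeL, compression_star, star_eq_adjoint,
    star_eq_adjoint, adjoint_adjoint, adjoint_adjoint] at this
  exact this

theorem compression_conj {K : Submodule ℂ E} {T : E →L[ℂ] E} (X : E →L[ℂ] E)
    (h : ∀ x ∈ K, star T x ∈ K) :
    compression K (T * X * star T) =
      compression K T * compression K X * star (compression K T) := by
  have h1 := compression_comp_orthogonalProjectionOnto h
  have h2 := subtypeL_comp_compression h
  rw [compression_star] at h2
  calc K.orthogonalProjectionOnto ∘L (T ∘L X ∘L star T) ∘L K.subtypeL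
      = (K.orthogonalProjectionOnto ∘L T) ∘L X ∘L (star T ∘L K.subtypeL) := by
        simp only [comp_assoc]
    _ = _ := by rw [h1, h2]; rfl

theorem compression_add (K : Submodule ℂ E) (S T : E →L[ℂ] E) :
    compression K (S + T) = compression K S + compression K T := by
  simp [compression]

theorem compression_sub (K : Submodule ℂ E) (S T : E →L[ℂ] E) :
    compression K (S - T) = compression K S - compression K T := by
  simp [compression]

theorem compression_smul (K : Submodule ℂ E) (a : ℂ) (T : E →L[ℂ] E) :
    compression K (a • T) = a • compression K T := by
  simp [compression]

theorem compression_one (K : Submodule ℂ E) : compression K (1 : E →L[ℂ] E) = 1 := by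
  ext x
  simp [compression]

theorem norm_compression_le (K : Submodule ℂ E) (T : E →L[ℂ] E) : ‖compression K T‖ ≤ ‖T‖ := by
  refine opNorm_le_bound _ (norm_nonneg _) fun x => ?_
  calc ‖K.orthogonalProjectionOnto (T x)‖ ≤ ‖T x‖ := K.norm_orthogonalProjectionOnto_apply_le _
    _ ≤ ‖T‖ * ‖(x : E)‖ := T.le_opNorm _

/-- In finite dimension, an operator all of whose eigenvalues lie in the open unit disc has
summable powers, by Gelfand's formula. -/
theorem summable_norm_pow_of_eigenvalues {T : E →L[ℂ] E}
    (h : ∀ (μ : ℂ) (v : E), v ≠ 0 → T v = μ • v → ‖μ‖ < 1) : Summable fun s : ℕ => ‖T ^ s‖ := by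
  rcases subsingleton_or_nontrivial E with hE | hE
  · have : ∀ S : E →L[ℂ] E, S = 0 := fun S => Subsingleton.elim _ _
    simp [this]
  have hs : ∀ z ∈ spectrum ℂ T, ‖z‖₊ < 1 := by
    intro z hz
    have hz' : z ∈ spectrum ℂ (T : E →ₗ[ℂ] E) := by
      rw [← AlgEquiv.spectrum_eq (Module.End.toContinuousLinearMap (𝕜 := ℂ) E).symm T] at hz
      exact hz
    obtain ⟨v, hv⟩ := (Module.End.hasEigenvalue_iff_mem_spectrum.2 hz').exists_hasEigenvector
    exact h z v hv.2 hv.apply_eq_smul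
  have hr : spectralRadius ℂ T < 1 := by
    simpa using spectrum.spectralRadius_lt_of_forall_lt T hs
  obtain ⟨ρ, h1, h2⟩ := ENNReal.lt_iff_exists_nnreal_btwn.1 hr
  have h2' : ρ < 1 := by exact_mod_cast h2
  have hev := (spectrum.pow_nnnorm_pow_one_div_tendsto_nhds_spectralRadius T).eventually
    (gt_mem_nhds h1)
  refine Summable.of_norm_bounded_eventually_nat (g := fun s : ℕ => (ρ : ℝ) ^ s)
    (summable_geometric_of_lt_one ρ.2 h2') ?_
  filter_upwards [hev, eventually_gt_atTop 0] with s hs hs0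
  rw [one_div, ENNReal.rpow_inv_lt_iff (by exact_mod_cast hs0), ENNReal.rpow_natCast] at hs
  rw [norm_norm]
  exact_mod_cast hs.le

/-- Off the unimodular eigenvectors a contraction has no eigenvalue of modulus one left. -/
theorem summable_norm_pow_compression {T : E →L[ℂ] E} (hT : ‖T‖ ≤ 1) :
    Summable fun s : ℕ => ‖compression (unimodularSpan T).orthogonal T ^ s‖ := by
  refine summable_norm_pow_of_eigenvalues fun μ v hv0 hv => ?_
  have hK : ∀ x ∈ (unimodularSpan T).orthogonal, T x ∈ (unimodularSpan T).orthogonal :=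
    fun x hx => apply_mem_orthogonal_of_star (fun u hu => star_apply_mem_unimodularSpan hT hu) hx
  have hTv : T v = μ • (v : E) := by
    have := DFunLike.congr_fun (subtypeL_comp_compression hK) v
    simpa [hv] using this
  have hv0' : (v : E) ≠ 0 := by simpa using hv0
  have hle : ‖μ‖ ≤ 1 := by
    have h1 := T.le_opNorm v
    rw [hTv, norm_smul] at h1
    exact (le_of_mul_le_mul_right h1 (norm_pos_iff.2 hv0')).trans hT
  refine lt_of_le_of_ne hle fun h1 => hv0' ?_
  have h2 : (v : E) ∈ unimodularSpan T := Submodule.subset_span ⟨μ, h1, hTv⟩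
  exact inner_self_eq_zero.1 (v.2 _ h2)

end Compression

section SteadySum

open ContinuousLinearMap

variable {F : Type*} [NormedAddCommGroup F] [InnerProductSpace ℂ F] [FiniteDimensional ℂ F]

/-- The fixed point `∑ s, S ^ s X (S†) ^ s` of the affine map `Γ ↦ X + S Γ S†`. -/
noncomputable def steadySum (S X : F →L[ℂ] F) : F →L[ℂ] F :=
  ∑' s : ℕ, S ^ s * X * star S ^ s

variable {S : F →L[ℂ] F}

theorem norm_pow_conj_le (hS : ‖S‖ ≤ 1) (X : F →L[ℂ] F) (s : ℕ) :
    ‖S ^ s * X * star S ^ s‖ ≤ ‖S ^ s‖ * ‖X‖ := by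
  have h1 : ‖star S ^ s‖ ≤ 1 := by
    rw [← star_pow]
    refine (adjoint.norm_map (S ^ s)).trans_le ?_
    rcases Nat.eq_zero_or_pos s with rfl | hs
    · exact norm_id_le (𝕜 := ℂ) (E := F)
    · exact (norm_pow_le' S hs).trans (pow_le_one₀ (norm_nonneg _) hS)
  calc ‖S ^ s * X * star S ^ s‖ ≤ ‖S ^ s * X‖ * ‖star S ^ s‖ := norm_mul_le _ _
    _ ≤ ‖S ^ s‖ * ‖X‖ * 1 := by gcongr; exact norm_mul_le _ _
    _ = _ := mul_one _

theorem summable_pow_conj (hS : ‖S‖ ≤ 1) (hs : Summable fun s : ℕ => ‖S ^ s‖) (X : F →L[ℂ] F) :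
    Summable fun s : ℕ => S ^ s * X * star S ^ s :=
  Summable.of_norm_bounded (hs.mul_right ‖X‖) (norm_pow_conj_le hS X)

theorem tendsto_pow_conj (hS : ‖S‖ ≤ 1) (hs : Summable fun s : ℕ => ‖S ^ s‖) (X : F →L[ℂ] F) :
    Tendsto (fun t : ℕ => S ^ t * X * star S ^ t) atTop (𝓝 0) :=
  (summable_pow_conj hS hs X).tendsto_atTop_zero

theorem tendsto_steadySum (hS : ‖S‖ ≤ 1) (hs : Summable fun s : ℕ => ‖S ^ s‖)
    {X : F →L[ℂ] F} {Γ : ℕ → F →L[ℂ] F} (hΓ : ∀ t, Γ (t + 1) = X + S * Γ t * star S) :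
    Tendsto Γ atTop (𝓝 (steadySum S X)) := by
  have h : ∀ t, Γ t = ∑ s ∈ Finset.range t, S ^ s * X * star S ^ s +
      S ^ t * Γ 0 * star S ^ t := by
    intro t
    induction t with
    | zero => simp
    | succ t ih =>
      rw [hΓ, ih, Finset.sum_range_succ', mul_add, add_mul, Finset.mul_sum, Finset.sum_mul,
        pow_zero, pow_zero, one_mul, mul_one, ← add_assoc, add_comm X]
      congr 1
      · congr 1
        refine Finset.sum_congr rfl fun s _ => ?_
        rw [pow_succ', pow_succ]; simp only [mul_assoc]
      · rw [pow_succ', pow_succ]; simp only [mul_assoc]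
  have := (summable_pow_conj hS hs X).hasSum.tendsto_sum_nat.add (tendsto_pow_conj hS hs (Γ 0))
  rw [add_zero] at this
  exact this.congr fun t => (h t).symm

theorem steadySum_add (hS : ‖S‖ ≤ 1) (hs : Summable fun s : ℕ => ‖S ^ s‖) (X Y : F →L[ℂ] F) :
    steadySum S (X + Y) = steadySum S X + steadySum S Y := by
  rw [steadySum, steadySum, steadySum,
    ← (summable_pow_conj hS hs X).tsum_add (summable_pow_conj hS hs Y)]
  simp only [mul_add, add_mul]

theorem steadySum_smul (hS : ‖S‖ ≤ 1) (hs : Summable fun s : ℕ => ‖S ^ s‖) (a : ℂ)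
    (X : F →L[ℂ] F) : steadySum S (a • X) = a • steadySum S X := by
  rw [steadySum, steadySum, ← (summable_pow_conj hS hs X).tsum_const_smul a]
  simp only [mul_smul_comm, smul_mul_assoc]

theorem steadySum_one_sub (hS : ‖S‖ ≤ 1) (hs : Summable fun s : ℕ => ‖S ^ s‖) :
    steadySum S (1 - S * star S) = 1 := by
  refine tendsto_nhds_unique (tendsto_steadySum hS hs (Γ := fun _ => 1) fun t => ?_)
    tendsto_const_nhds
  simp

theorem steadySum_star (S X : F →L[ℂ] F) : star (steadySum S X) = steadySum S (star X) := by
  rw [steadySum, steadySum, tsum_star]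
  simp only [star_mul, star_pow, star_star, mul_assoc]

open ComplexOrder in
theorem steadySum_isPositive (hS : ‖S‖ ≤ 1) (hs : Summable fun s : ℕ => ‖S ^ s‖)
    {X : F →L[ℂ] F} (hX : X.IsPositive) : (steadySum S X).IsPositive := by
  refine (isPositive_iff' _).2 ⟨?_, fun x => ?_⟩
  · rw [IsSelfAdjoint, steadySum_star, hX.isSelfAdjoint.star_eq]
  · have h1 := (summable_pow_conj hS hs X).hasSum.mapL (apply ℂ F x)
    have h2 := h1.mapL ((innerSL ℂ).flip x)
    refine h2.nonneg fun s => ?_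
    have h3 := (hX.conj_adjoint (S ^ s)).inner_nonneg_left x
    rw [← star_eq_adjoint, star_pow] at h3
    exact h3

/-- The Abel means of the series defining `steadySum`. -/
noncomputable def abelSum (S X : F →L[ℂ] F) (r : ℝ) : F →L[ℂ] F :=
  ∑' s : ℕ, r ^ s • (S ^ s * X * star S ^ s)

theorem abelSum_one (S X : F →L[ℂ] F) : abelSum S X 1 = steadySum S X := by
  simp [abelSum, steadySum]

theorem norm_abelSum_term_le (hS : ‖S‖ ≤ 1) (X : F →L[ℂ] F) {r : ℝ} (hr : r ∈ Set.Icc (0 : ℝ) 1)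
    (s : ℕ) : ‖r ^ s • (S ^ s * X * star S ^ s)‖ ≤ ‖S ^ s‖ * ‖X‖ := by
  rw [norm_smul, norm_pow, Real.norm_of_nonneg hr.1]
  calc r ^ s * _ ≤ 1 * (‖S ^ s‖ * ‖X‖) := by
        gcongr
        · exact pow_le_one₀ hr.1 hr.2
        · exact norm_pow_conj_le hS X s
    _ = _ := one_mul _

theorem continuousOn_abelSum (hS : ‖S‖ ≤ 1) (hs : Summable fun s : ℕ => ‖S ^ s‖)
    (X : F →L[ℂ] F) : ContinuousOn (abelSum S X) (Set.Icc 0 1) := by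
  refine continuousOn_tsum (fun s => by fun_prop) (hs.mul_right ‖X‖) fun s r hr => ?_
  exact norm_abelSum_term_le hS X hr s

theorem abelSum_eq (hS : ‖S‖ ≤ 1) (hs : Summable fun s : ℕ => ‖S ^ s‖)
    (X : F →L[ℂ] F) {r : ℝ} (hr : r ∈ Set.Icc (0 : ℝ) 1) :
    abelSum S X r = X + r • (S * abelSum S X r * star S) := by
  have h : Summable fun s : ℕ => r ^ s • (S ^ s * X * star S ^ s) :=
    Summable.of_norm_bounded (hs.mul_right ‖X‖) (norm_abelSum_term_le hS X hr)
  conv_lhs => rw [abelSum, h.tsum_eq_zero_add]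
  rw [abelSum, ← h.tsum_mul_left, ← (h.mul_left S).tsum_mul_right,
    ← ((h.mul_left S).mul_right (star S)).tsum_const_smul]
  congr 1
  · simp
  · refine tsum_congr fun s => ?_
    rw [pow_succ', pow_succ' S, pow_succ (star S), mul_smul_comm, smul_mul_assoc, smul_smul]
    simp only [mul_assoc]

end SteadySum

/-! ### The steady state of a completely positive Gaussian map -/

section ChannelPair

open ContinuousLinearMap

variable {E : Type*} [NormedAddCommGroup E] [InnerProductSpace ℂ E] [FiniteDimensional ℂ E]

/-- The affine map `Γ ↦ A + T Γ T†` preserves the set of skew-adjoint `Γ` with `-1 ≤ i Γ ≤ 1`: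
complete positivity of a Gaussian channel, in the form `1 - T T† ± i A ≥ 0`. -/
structure IsChannelPair (T A : E →L[ℂ] E) : Prop where
  pos_add : (1 - T * star T + Complex.I • A).IsPositive
  pos_sub : (1 - T * star T - Complex.I • A).IsPositive

theorem apply_eq_zero_of_isPositive {P : E →L[ℂ] E} (hP : P.IsPositive) {u : E}
    (h : RCLike.re (inner ℂ (P u) u) = 0) : P u = 0 := by
  obtain ⟨S, rfl⟩ := CStarAlgebra.nonneg_iff_eq_star_mul_self.1 ((nonneg_iff_isPositive P).2 hP)
  have h1 : S u = 0 := by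
    rw [mul_apply_eq_comp, star_eq_adjoint, adjoint_inner_left, inner_self_eq_norm_sq] at h
    simpa using h
  rw [mul_apply_eq_comp, h1, map_zero]

theorem isPositive_compression {P : E →L[ℂ] E} (hP : P.IsPositive) (K : Submodule ℂ E) :
    (compression K P).IsPositive := by
  have := hP.conj_adjoint (K.orthogonalProjectionOnto)
  rwa [Submodule.adjoint_orthogonalProjectionOnto] at this

namespace IsChannelPair

variable {T A : E →L[ℂ] E}

theorem isPositive_one_sub (h : IsChannelPair T A) : (1 - T * star T).IsPositive := by
  have h1 := (h.pos_add.add h.pos_sub).smul_of_nonneg (c := ((1 / 2 : ℝ) : ℂ)) (by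
    rw [Complex.zero_le_real]; norm_num)
  convert h1 using 1
  module

theorem norm_le_one (h : IsChannelPair T A) : ‖T‖ ≤ 1 := by
  rw [← adjoint.norm_map T]
  refine opNorm_le_bound _ zero_le_one fun x => ?_
  have h1 := h.isPositive_one_sub.re_inner_nonneg_left x
  rw [sub_apply, one_apply_eq_self, mul_apply_eq_comp, inner_sub_left, ← adjoint_inner_right,
    ← star_eq_adjoint, map_sub, inner_self_eq_norm_sq, inner_self_eq_norm_sq] at h1
  rw [one_mul, ← abs_of_nonneg (norm_nonneg x), ← abs_of_nonneg (norm_nonneg (adjoint T x))]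
  exact sq_le_sq.1 (sub_nonneg.1 h1)

theorem star_eq_neg (h : IsChannelPair T A) : star A = -A := by
  have h1 := h.pos_add.isSelfAdjoint.star_eq
  have h2 := h.isPositive_one_sub.isSelfAdjoint.star_eq
  rw [star_add, h2, star_smul, add_right_inj] at h1
  have h3 : Complex.I • (star A + A) = 0 := by
    rw [smul_add, ← h1]; simp
  have h4 := (smul_eq_zero.1 h3).resolve_left Complex.I_ne_zero
  exact eq_neg_of_add_eq_zero_left h4

/-- The noise does not act on the preserved modes, since there `1 - T T† = 0`. -/
theorem apply_eq_zero (h : IsChannelPair T A) {u : E} (hu : u ∈ unimodularSpan T) : A u = 0 := by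
  have h0 : (1 - T * star T) u = 0 := by
    rw [sub_apply, one_apply_eq_self, mul_apply_eq_comp,
      apply_star_apply_of_mem_unimodularSpan h.norm_le_one hu, sub_self]
  have h1 := h.pos_add.re_inner_nonneg_left u
  have h2 := h.pos_sub.re_inner_nonneg_left u
  have h3 : (1 - T * star T + Complex.I • A) u = 0 := by
    refine apply_eq_zero_of_isPositive h.pos_add (le_antisymm ?_ h1)
    rw [sub_apply, h0, zero_sub, inner_neg_left, map_neg] at h2
    rw [add_apply, h0, zero_add]
    linarith
  rw [add_apply, h0, zero_add, smul_apply] at h3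
  exact (smul_eq_zero.1 h3).resolve_left Complex.I_ne_zero

end IsChannelPair

/-- The steady state of the dissipative modes of `Γ ↦ A + T Γ T†`. -/
noncomputable def steadyOn (T A : E →L[ℂ] E) :
    (unimodularSpan T).orthogonal →L[ℂ] (unimodularSpan T).orthogonal :=
  steadySum (compression (unimodularSpan T).orthogonal T)
    (compression (unimodularSpan T).orthogonal A)

namespace IsChannelPair

variable {T A : E →L[ℂ] E}

theorem star_apply_mem_orthogonal (_ : IsChannelPair T A) :
    ∀ x ∈ (unimodularSpan T).orthogonal, star T x ∈ (unimodularSpan T).orthogonal := by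
  intro x hx
  refine apply_mem_orthogonal_of_star (fun u hu => ?_) hx
  rw [star_star]
  exact apply_mem_unimodularSpan hu

theorem apply_mem_orthogonal (h : IsChannelPair T A) :
    ∀ x ∈ (unimodularSpan T).orthogonal, T x ∈ (unimodularSpan T).orthogonal := fun _ hx =>
  apply_mem_orthogonal_of_star (fun _ hu => star_apply_mem_unimodularSpan h.norm_le_one hu) hx

theorem norm_compression_le_one (h : IsChannelPair T A) (K : Submodule ℂ E) :
    ‖compression K T‖ ≤ 1 :=
  (norm_compression_le K T).trans h.norm_le_one

theorem tendsto_compression_iterate (h : IsChannelPair T A) {Γ : ℕ → E →L[ℂ] E}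
    (hΓ : ∀ t, Γ (t + 1) = A + T * Γ t * star T) :
    Tendsto (fun t => compression (unimodularSpan T).orthogonal (Γ t)) atTop
      (𝓝 (steadyOn T A)) := by
  refine tendsto_steadySum (h.norm_compression_le_one _)
    (summable_norm_pow_compression h.norm_le_one) fun t => ?_
  rw [hΓ, compression_add, compression_conj _ h.star_apply_mem_orthogonal]

theorem compression_isChannelPair (h : IsChannelPair T A) :
    IsChannelPair (compression (unimodularSpan T).orthogonal T)
      (compression (unimodularSpan T).orthogonal A) := by
  have h1 := compression_conj (1 : E →L[ℂ] E) h.star_apply_mem_orthogonal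
  rw [compression_one, mul_one, mul_one] at h1
  constructor
  · have := isPositive_compression h.pos_add (unimodularSpan T).orthogonal
    rwa [compression_add, compression_sub, compression_smul, compression_one, h1] at this
  · have := isPositive_compression h.pos_sub (unimodularSpan T).orthogonal
    rwa [compression_sub, compression_sub, compression_smul, compression_one, h1] at this

theorem isPositive_one_add_steadyOn (h : IsChannelPair T A) :
    (1 + Complex.I • steadyOn T A).IsPositive := by
  have hS := h.norm_compression_le_one (unimodularSpan T).orthogonal
  have hs := summable_norm_pow_compression h.norm_le_one
  have := steadySum_isPositive hS hs h.compression_isChannelPair.pos_add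
  rwa [steadySum_add hS hs, steadySum_one_sub hS hs, steadySum_smul hS hs] at this

theorem isPositive_one_sub_steadyOn (h : IsChannelPair T A) :
    (1 - Complex.I • steadyOn T A).IsPositive := by
  have hS := h.norm_compression_le_one (unimodularSpan T).orthogonal
  have hs := summable_norm_pow_compression h.norm_le_one
  have := steadySum_isPositive hS hs h.compression_isChannelPair.pos_sub
  rwa [sub_eq_add_neg, ← neg_smul, steadySum_add hS hs, steadySum_one_sub hS hs,
    steadySum_smul hS hs, neg_smul, ← sub_eq_add_neg] at this

/-- `-i` times the steady state is self-adjoint. -/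
theorem isSymmetric_steadyOn (h : IsChannelPair T A) :
    ((-Complex.I • steadyOn T A : _ →L[ℂ] _) :
      (unimodularSpan T).orthogonal →ₗ[ℂ] (unimodularSpan T).orthogonal).IsSymmetric := by
  have h1 := h.isPositive_one_sub_steadyOn.isSelfAdjoint.sub (IsSelfAdjoint.one _)
  rw [sub_sub_cancel_left, ← neg_smul] at h1
  exact isSelfAdjoint_iff_isSymmetric.1 h1

/-- The eigenvalues `l` of `-i` times the steady state, with multiplicity. -/
noncomputable def levels (h : IsChannelPair T A) :
    Fin (Module.finrank ℂ (unimodularSpan T).orthogonal) → ℝ :=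
  h.isSymmetric_steadyOn.eigenvalues rfl

theorem levels_mem (h : IsChannelPair T A) (i) : h.levels i ∈ Set.Icc (-1 : ℝ) 1 := by
  set v := h.isSymmetric_steadyOn.eigenvectorBasis rfl i with hv
  have h1 : (-Complex.I • steadyOn T A) v = (h.levels i : ℂ) • v :=
    h.isSymmetric_steadyOn.apply_eigenvectorBasis rfl i
  have h2 : Complex.I • steadyOn T A v = -((h.levels i : ℂ) • v) := by
    rw [← h1, smul_apply, neg_smul, neg_neg]
  have hn : ‖v‖ = 1 := (h.isSymmetric_steadyOn.eigenvectorBasis rfl).norm_eq_one i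
  have h3 := h.isPositive_one_add_steadyOn.re_inner_nonneg_left v
  have h4 := h.isPositive_one_sub_steadyOn.re_inner_nonneg_left v
  rw [add_apply, smul_apply, h2, one_apply_eq_self, inner_add_left, inner_neg_left, inner_smul_left,
    inner_self_eq_norm_sq_to_K, hn] at h3
  rw [sub_apply, smul_apply, h2, one_apply_eq_self, inner_sub_left, inner_neg_left, inner_smul_left,
    inner_self_eq_norm_sq_to_K, hn] at h4
  simp at h3 h4
  constructor <;> linarith

end IsChannelPair

open Polynomial in
theorem roots_charpoly_of_basis {F ι : Type*} [AddCommGroup F] [Module ℂ F] [Module.Finite ℂ F]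
    [Fintype ι] [DecidableEq ι] (b : Module.Basis ι ℂ F) {f : F →ₗ[ℂ] F} {d : ι → ℂ}
    (h : ∀ i, f (b i) = d i • b i) : f.charpoly.roots = Finset.univ.val.map d := by
  have h1 : LinearMap.toMatrix b b f = Matrix.diagonal d := by
    ext i j
    rw [LinearMap.toMatrix_apply, h, map_smul, Finsupp.smul_apply, b.repr_self,
      Matrix.diagonal_apply, Finsupp.single_apply]
    split_ifs <;> simp_all
  rw [← LinearMap.charpoly_toMatrix f b, h1, Matrix.charpoly_diagonal, Polynomial.roots_prod _ _ (by
      simp [Finset.prod_ne_zero_iff, Polynomial.X_sub_C_ne_zero])]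
  simp

namespace IsChannelPair

variable {T A : E →L[ℂ] E}

theorem roots_charpoly_smul_add (h : IsChannelPair T A) (a c : ℂ) :
    (LinearMap.charpoly (a • 1 + c • (-Complex.I • steadyOn T A) : _ →L[ℂ] _).toLinearMap).roots =
      Finset.univ.val.map fun i => a + c * (h.levels i : ℂ) := by
  refine roots_charpoly_of_basis (h.isSymmetric_steadyOn.eigenvectorBasis rfl).toBasis fun i => ?_
  have h1 : (-Complex.I • steadyOn T A) (h.isSymmetric_steadyOn.eigenvectorBasis rfl i) =
      (h.levels i : ℂ) • (h.isSymmetric_steadyOn.eigenvectorBasis rfl i) :=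
    h.isSymmetric_steadyOn.apply_eigenvectorBasis rfl i
  rw [OrthonormalBasis.coe_toBasis, add_smul, mul_smul, ← h1]
  rfl

theorem roots_charpoly_steadyOn (h : IsChannelPair T A) :
    (LinearMap.charpoly (steadyOn T A).toLinearMap).roots =
      Finset.univ.val.map fun i => Complex.I * (h.levels i : ℂ) := by
  have := h.roots_charpoly_smul_add 0 Complex.I
  simpa [smul_smul] using this

end IsChannelPair

/-- The operator `3 - i Γ` on the dissipative modes, where `Γ` is their steady state, extended by
zero to the preserved modes.  As `-1 ≤ -i Γ ≤ 1`, the shift by `3` separates the two parts of the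
spectrum. -/
noncomputable def shiftedSteady (T A : E →L[ℂ] E) : E →L[ℂ] E :=
  (unimodularSpan T).orthogonal.subtypeL ∘L ((3 : ℂ) • 1 + (1 : ℂ) • (-Complex.I • steadyOn T A)) ∘L
    (unimodularSpan T).orthogonal.orthogonalProjectionOnto

/-- The inhomogeneity whose steady state is `shiftedSteady`. -/
noncomputable def shiftedNoise (T A : E →L[ℂ] E) : E →L[ℂ] E :=
  (3 : ℂ) • (1 - T * star T) + -Complex.I • A

namespace IsChannelPair

variable {T A : E →L[ℂ] E}

theorem shiftedNoise_apply_eq_zero (h : IsChannelPair T A) {u : E} (hu : u ∈ unimodularSpan T) :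
    shiftedNoise T A u = 0 := by
  simp [shiftedNoise, h.apply_eq_zero hu, apply_star_apply_of_mem_unimodularSpan h.norm_le_one hu]

theorem isSelfAdjoint_shiftedNoise (h : IsChannelPair T A) : IsSelfAdjoint (shiftedNoise T A) := by
  rw [IsSelfAdjoint, shiftedNoise, star_add, star_smul, star_smul, h.star_eq_neg,
    h.isPositive_one_sub.isSelfAdjoint.star_eq]
  simp

theorem shiftedNoise_eq (h : IsChannelPair T A) :
    shiftedNoise T A = (unimodularSpan T).orthogonal.subtypeL ∘L
      compression (unimodularSpan T).orthogonal (shiftedNoise T A) ∘L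
        (unimodularSpan T).orthogonal.orthogonalProjectionOnto := by
  have h1 : ∀ x ∈ (unimodularSpan T).orthogonal,
      shiftedNoise T A x ∈ (unimodularSpan T).orthogonal := fun x hx =>
    apply_mem_orthogonal_of_star (fun u hu => by
      rw [h.isSelfAdjoint_shiftedNoise.star_eq, h.shiftedNoise_apply_eq_zero hu]
      exact Submodule.zero_mem _) hx
  rw [← comp_assoc, ← subtypeL_comp_compression h1]
  ext x
  have h2 := (unimodularSpan T).starProjection_add_starProjection_orthogonal x
  conv_lhs => rw [← h2]
  rw [map_add, h.shiftedNoise_apply_eq_zero (Submodule.starProjection_apply_mem _ x), zero_add]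
  rfl

theorem steadySum_shiftedNoise (h : IsChannelPair T A) :
    steadySum (compression (unimodularSpan T).orthogonal T)
      (compression (unimodularSpan T).orthogonal (shiftedNoise T A)) =
        (3 : ℂ) • 1 + (1 : ℂ) • (-Complex.I • steadyOn T A) := by
  have hS := h.norm_compression_le_one (unimodularSpan T).orthogonal
  have hs := summable_norm_pow_compression h.norm_le_one
  have h1 := compression_conj (1 : E →L[ℂ] E) h.star_apply_mem_orthogonal
  rw [compression_one, mul_one, mul_one] at h1
  rw [shiftedNoise, compression_add, compression_smul, compression_smul, compression_sub, h1,
    compression_one, steadySum_add hS hs, steadySum_smul hS hs, steadySum_smul hS hs,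
    steadySum_one_sub hS hs, one_smul]
  rfl

/-- The steady state is the limit at `r = 1` of solutions of the equations
`G = C + r T G T†`. -/
theorem exists_abel_family (h : IsChannelPair T A) :
    ∃ G : ℝ → E →L[ℂ] E, ContinuousOn G (Set.Icc 0 1) ∧ G 1 = shiftedSteady T A ∧
      ∀ r ∈ Set.Icc (0 : ℝ) 1, G r = shiftedNoise T A + r • (T * G r * star T) := by
  have hS := h.norm_compression_le_one (unimodularSpan T).orthogonal
  have hs := summable_norm_pow_compression h.norm_le_one
  set K := (unimodularSpan T).orthogonal
  set g := abelSum (compression K T) (compression K (shiftedNoise T A))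
  refine ⟨fun r => K.subtypeL ∘L g r ∘L K.orthogonalProjectionOnto, ?_, ?_, fun r hr => ?_⟩
  · exact continuousOn_const.clm_comp ((continuousOn_abelSum hS hs _).clm_comp continuousOn_const)
  · change K.subtypeL ∘L g 1 ∘L K.orthogonalProjectionOnto = _
    rw [show g 1 = _ from abelSum_one _ _, h.steadySum_shiftedNoise]
    rfl
  · have h1 := subtypeL_comp_compression h.apply_mem_orthogonal
    have h2 := compression_comp_orthogonalProjectionOnto (K := K) (T := star T) (by
      rw [star_star]; exact h.apply_mem_orthogonal)
    rw [compression_star] at h2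
    have h3 : T * (K.subtypeL ∘L g r ∘L K.orthogonalProjectionOnto) * star T =
        K.subtypeL ∘L (compression K T * g r * star (compression K T)) ∘L
          K.orthogonalProjectionOnto := by
      calc _ = (T ∘L K.subtypeL) ∘L g r ∘L (K.orthogonalProjectionOnto ∘L star T) := rfl
        _ = _ := by rw [h1, h2]; rfl
    change K.subtypeL ∘L g r ∘L K.orthogonalProjectionOnto = _
    rw [h3]
    conv_lhs => rw [show g r = _ from abelSum_eq hS hs _ hr]
    conv_rhs => rw [h.shiftedNoise_eq]
    rw [add_comp, comp_add, smul_comp, comp_smul]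

theorem norm_shiftedSteady_le (h : IsChannelPair T A) : ‖shiftedSteady T A‖ ≤ 4 := by
  set K := (unimodularSpan T).orthogonal
  have h0 : ‖(1 - Complex.I • steadyOn T A : K →L[ℂ] K)‖ ≤ 2 := by
    refine (CStarAlgebra.norm_le_iff_le_algebraMap _ zero_le_two
      ((nonneg_iff_isPositive _).2 h.isPositive_one_sub_steadyOn)).2 ?_
    rw [ContinuousLinearMap.le_def]
    convert h.isPositive_one_add_steadyOn using 1
    rw [Algebra.algebraMap_eq_smul_one, two_smul]
    abel
  have h1 : ‖((3 : ℂ) • 1 + (1 : ℂ) • (-Complex.I • steadyOn T A) : K →L[ℂ] K)‖ ≤ 4 := by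
    have : ((3 : ℂ) • 1 + (1 : ℂ) • (-Complex.I • steadyOn T A) : K →L[ℂ] K) =
        (2 : ℂ) • 1 + (1 - Complex.I • steadyOn T A) := by module
    rw [this]
    have h2 : ‖((2 : ℂ) • 1 : K →L[ℂ] K)‖ ≤ 2 := by
      refine opNorm_le_bound _ zero_le_two fun x => ?_
      change ‖(2 : ℂ) • x‖ ≤ _
      rw [norm_smul, Complex.norm_ofNat]
    exact (ContinuousLinearMap.opNorm_add_le _ _).trans (by linarith)
  refine opNorm_le_bound _ (by norm_num) fun x => ?_
  calc ‖shiftedSteady T A x‖ = ‖((3 : ℂ) • 1 + (1 : ℂ) • (-Complex.I • steadyOn T A) :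
          K →L[ℂ] K) (K.orthogonalProjectionOnto x)‖ := rfl
    _ ≤ 4 * ‖K.orthogonalProjectionOnto x‖ := le_of_opNorm_le _ h1 _
    _ ≤ 4 * ‖x‖ := by gcongr; exact K.norm_orthogonalProjectionOnto_apply_le x

theorem isSelfAdjoint_shiftedSteady (h : IsChannelPair T A) :
    IsSelfAdjoint (shiftedSteady T A) := by
  have h1 : IsSelfAdjoint ((3 : ℂ) • 1 + (1 : ℂ) • (-Complex.I • steadyOn T A) :
      (unimodularSpan T).orthogonal →L[ℂ] (unimodularSpan T).orthogonal) := by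
    rw [one_smul]
    refine IsSelfAdjoint.add ?_ (isSelfAdjoint_iff_isSymmetric.2 h.isSymmetric_steadyOn)
    rw [IsSelfAdjoint, star_smul, star_one]
    simp
  have := h1.conj_adjoint (unimodularSpan T).orthogonal.subtypeL
  rwa [Submodule.adjoint_subtypeL] at this

theorem roots_charpoly_shiftedSteady (h : IsChannelPair T A) :
    (LinearMap.charpoly (shiftedSteady T A).toLinearMap).roots =
      (Finset.univ.val.map fun i => 3 + (h.levels i : ℂ)) +
        Multiset.replicate (Module.finrank ℂ (unimodularSpan T).orthogonal.orthogonal) 0 := by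
  set K := (unimodularSpan T).orthogonal
  set f : K →L[ℂ] K := (3 : ℂ) • 1 + (1 : ℂ) • (-Complex.I • steadyOn T A) with hf
  have h1 : (shiftedSteady T A).toLinearMap =
      (Submodule.prodEquivOfIsCompl K K.orthogonal K.isCompl_orthogonal).conj
        (LinearMap.prodMap f.toLinearMap 0) := by
    ext x
    obtain ⟨y, rfl⟩ := (Submodule.prodEquivOfIsCompl K K.orthogonal
      K.isCompl_orthogonal).surjective x
    rw [LinearEquiv.conj_apply_apply, LinearEquiv.symm_apply_apply,
      Submodule.coe_prodEquivOfIsCompl', Submodule.coe_prodEquivOfIsCompl']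
    have h2 : K.orthogonalProjectionOnto ((y.1 : E) + y.2) = y.1 := by
      rw [map_add, Submodule.orthogonalProjectionOnto_mem_subspace_eq_self,
        Submodule.orthogonalProjectionOnto_apply_of_mem_orthogonal y.2.2, add_zero]
    change ((f (K.orthogonalProjectionOnto ((y.1 : E) + y.2)) : K) : E) = f y.1 + 0
    rw [h2, add_zero]
  rw [h1, LinearEquiv.charpoly_conj, LinearMap.charpoly_prodMap, LinearMap.charpoly_zero,
    Polynomial.roots_mul, h.roots_charpoly_smul_add]
  · rw [Polynomial.roots_X_pow, Multiset.nsmul_singleton]; simp only [one_mul]; rfl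
  · exact mul_ne_zero (LinearMap.charpoly_monic _).ne_zero (by simp)

/-- The spectrum of the steady state is read off from the part of the spectrum of `shiftedSteady`
above `1`, which excludes exactly the zeros contributed by the preserved modes. -/
theorem map_levels_eq (h : IsChannelPair T A) {α : Type*} (φ : ℝ → α) :
    ((LinearMap.charpoly (steadyOn T A).toLinearMap).roots.map fun z => φ z.im) =
      (((LinearMap.charpoly (shiftedSteady T A).toLinearMap).roots.map Complex.re).filter
        (1 ≤ ·)).map fun x => φ (x - 3) := by
  rw [h.roots_charpoly_steadyOn, h.roots_charpoly_shiftedSteady, Multiset.map_add,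
    Multiset.filter_add, Multiset.filter_eq_self.2, Multiset.filter_eq_nil.2]
  · rw [add_zero, Multiset.map_map, Multiset.map_map, Multiset.map_map]
    exact Multiset.map_congr rfl fun i _ => by simp
  · intro x hx
    obtain ⟨z, hz, rfl⟩ := Multiset.mem_map.1 hx
    rw [Multiset.eq_of_mem_replicate hz]
    simp
  · intro x hx
    have := h.levels_mem
    simp at hx
    obtain ⟨i, rfl⟩ := hx
    linarith [(this i).1]

end IsChannelPair

end ChannelPair

/-! ### Complete positivity in momentum space -/

section MatrixChannel

open Matrix ComplexOrder

variable {ι : Type}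

theorem complexify_conjTranspose (M : Matrix ι ι ℝ) :
    (complexify M)ᴴ = complexify M.transpose := by
  ext i j
  simp [complexify]

theorem complexify_mul [Fintype ι] (M N : Matrix ι ι ℝ) :
    complexify (M * N) = complexify M * complexify N :=
  Matrix.map_mul (f := Complex.ofRealHom)

variable [Fintype ι]

theorem posSemidef_complexify {M : Matrix ι ι ℝ} (hM : M.PosSemidef) :
    (complexify M).PosSemidef := by
  obtain ⟨m, v, rfl⟩ := posSemidef_iff_eq_sum_vecMulVec.1 hM
  have h : complexify (∑ i, vecMulVec (v i) (star (v i))) =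
      ∑ i, vecMulVec (fun a => (v i a : ℂ)) (star fun a => (v i a : ℂ)) := by
    ext a b
    simp [complexify, Matrix.sum_apply, vecMulVec_apply]
  rw [h]
  exact posSemidef_sum _ fun i _ => posSemidef_vecMulVec_self_star _

variable [DecidableEq ι]

/-- Complete positivity of the complex Gaussian map `Γ ↦ A + B Γ B†`, in the form
`1 - B B† ± i A ≥ 0`; the two signs are written as the square roots `c` of `-1`. -/
def IsMatrixChannel (B A : Matrix ι ι ℂ) : Prop :=
  ∀ c : ℂ, c * c = -1 → (1 - B * Bᴴ + c • A).PosSemidef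

theorem star_eq_neg_of_mul_self {c : ℂ} (hc : c * c = -1) : star c = -c := by
  have h : (c - Complex.I) * (c + Complex.I) = 0 := by
    linear_combination hc - Complex.I_mul_I
  rcases mul_eq_zero.1 h with h | h
  · rw [sub_eq_zero.1 h]; simp
  · rw [eq_neg_of_add_eq_zero_left h]; simp

/-- An anti-Hermitian contraction `Λ` satisfies `1 + c Λ ≥ 0` for `c = ± i`: with `H = c Λ`
Hermitian, `2 (1 + H) = (1 + H) ^ 2 + (1 - H ^ 2)`. -/
theorem posSemidef_one_add_smul {M : Matrix ι ι ℂ} (hM : Mᴴ = -M) (h1 : (1 - Mᴴ * M).PosSemidef)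
    {c : ℂ} (hc : c * c = -1) : (1 + c • M).PosSemidef := by
  have hH : (1 + c • M)ᴴ = 1 + c • M := by
    rw [conjTranspose_add, conjTranspose_one, conjTranspose_smul, hM, star_eq_neg_of_mul_self hc,
      smul_neg, neg_smul, neg_neg]
  have h2 := (posSemidef_conjTranspose_mul_self (1 + c • M)).add h1
  rw [hH, hM] at h2
  have h3 : (1 + c • M) * (1 + c • M) + (1 - -M * M) = (2 : ℝ) • (1 + c • M) := by
    rw [add_mul, mul_add, mul_add, smul_mul_smul_comm, hc, one_mul, mul_one, one_mul, neg_mul,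
      neg_smul, one_smul, two_smul]
    abel
  rw [h3] at h2
  have h4 := h2.smul (show (0 : ℝ) ≤ 1 / 2 by norm_num)
  rwa [smul_smul, show (1 / 2 : ℝ) * 2 = 1 by norm_num, one_smul] at h4

/-- The Schur complement of the condition `Λ† Λ ≤ 1`. -/
theorem GaussianChannel.isMatrixChannel (N : GaussianChannel ι) :
    IsMatrixChannel (complexify N.B) (complexify N.A) := by
  intro c hc
  set Λ : Matrix (ι ⊕ ι) (ι ⊕ ι) ℝ := Matrix.fromBlocks N.A N.B (-N.B.transpose) 0 with hΛ
  have h0 : complexify Λ = fromBlocks (complexify N.A) (complexify N.B) (-(complexify N.B)ᴴ) 0 := by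
    ext (i | i) (j | j) <;> simp [complexify, hΛ]
  have h1 : (complexify Λ)ᴴ = -complexify Λ := by
    rw [h0, fromBlocks_conjTranspose, fromBlocks_neg, complexify_conjTranspose N.A, N.antisymm,
      conjTranspose_neg, conjTranspose_conjTranspose]
    congr 1
    · ext; simp [complexify]
    · rw [neg_neg]
    · rw [conjTranspose_zero, neg_zero]
  have h2 : (1 - (complexify Λ)ᴴ * complexify Λ).PosSemidef := by
    have := posSemidef_complexify N.cptp
    convert this using 1
    rw [complexify_conjTranspose, ← complexify_mul]
    ext i j
    rw [← hΛ]
    simp [complexify, Matrix.one_apply]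
    split_ifs <;> simp
  have h3 := (posSemidef_one_add_smul h1 h2 hc).conjTranspose_mul_mul_same
    (fromRows 1 (c • (complexify N.B)ᴴ))
  convert h3 using 1
  rw [h0, ← fromBlocks_one, fromBlocks_smul, fromBlocks_add,
    conjTranspose_fromRows_eq_fromCols_conjTranspose, Matrix.mul_assoc, fromBlocks_mul_fromRows,
    fromCols_mul_fromRows, conjTranspose_smul,
    star_eq_neg_of_mul_self hc]
  simp only [conjTranspose_one, mul_one, one_mul, conjTranspose_conjTranspose, smul_neg, zero_add,
    smul_zero, add_zero, neg_smul, mul_add, smul_mul_assoc, mul_smul_comm, smul_smul, hc,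
    mul_neg, neg_add_cancel, mul_zero]
  simp only [one_smul]
  abel

theorem IsMatrixChannel.conj {B A : Matrix ι ι ℂ} (h : IsMatrixChannel B A) {U : Matrix ι ι ℂ}
    (hU : U * Uᴴ = 1) : IsMatrixChannel (U * B * Uᴴ) (U * A * Uᴴ) := by
  intro c hc
  have hU' : Uᴴ * U = 1 := mul_eq_one_comm.1 hU
  have h1 := (h c hc).mul_mul_conjTranspose_same U
  convert h1 using 1
  rw [conjTranspose_mul, conjTranspose_mul, conjTranspose_conjTranspose, mul_add, mul_sub, add_mul,
    sub_mul, mul_one, hU, mul_smul_comm, smul_mul_assoc]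
  congr 2
  calc U * B * Uᴴ * (U * (Bᴴ * Uᴴ)) = U * B * (Uᴴ * U) * (Bᴴ * Uᴴ) := by simp only [mul_assoc]
    _ = _ := by rw [hU', mul_one]; simp only [mul_assoc]

theorem IsMatrixChannel.comp {B₁ A₁ B₂ A₂ : Matrix ι ι ℂ} (h₂ : IsMatrixChannel B₂ A₂)
    (h₁ : IsMatrixChannel B₁ A₁) : IsMatrixChannel (B₂ * B₁) (A₂ + B₂ * A₁ * B₂ᴴ) := by
  intro c hc
  have h := (h₂ c hc).add ((h₁ c hc).mul_mul_conjTranspose_same B₂)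
  convert h using 1
  rw [conjTranspose_mul, mul_add, mul_sub, add_mul, sub_mul, mul_one, mul_smul_comm,
    smul_mul_assoc, smul_add]
  simp only [mul_assoc]
  abel

theorem IsMatrixChannel.isChannelPair {B A : Matrix ι ι ℂ} (h : IsMatrixChannel B A) :
    IsChannelPair (toEuclideanCLM (𝕜 := ℂ) B) (toEuclideanCLM (𝕜 := ℂ) A) := by
  have key : ∀ {M : Matrix ι ι ℂ}, M.PosSemidef → (toEuclideanCLM (𝕜 := ℂ) M).IsPositive := by
    intro M hM
    rw [← ContinuousLinearMap.isPositive_toLinearMap_iff, coe_toEuclideanCLM_eq_toEuclideanLin]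
    exact isPositive_toEuclideanLin_iff.2 hM
  constructor
  · have := key (h Complex.I Complex.I_mul_I)
    rwa [map_add, map_sub, map_one, map_mul, map_smul, ← star_eq_conjTranspose, map_star] at this
  · have := key (h (-Complex.I) (by simp))
    rw [map_add, map_sub, map_one, map_mul, map_smul, ← star_eq_conjTranspose, map_star] at this
    convert this using 1
    module

end MatrixChannel

section Period

open Matrix

variable {n : ℕ}

theorem star_exp_I_mul (k : ℝ) :
    star (Complex.exp (Complex.I * k)) = Complex.exp (-(Complex.I * k)) := by
  rw [← starRingEnd_apply, ← Complex.exp_conj]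
  simp

theorem exp_I_mul_star (k : ℝ) :
    Complex.exp (Complex.I * k) * star (Complex.exp (Complex.I * k)) = 1 := by
  rw [star_exp_I_mul, ← Complex.exp_add, add_neg_cancel, Complex.exp_zero]

theorem shiftSymbol_mul_conjTranspose (n : ℕ) (k : ℝ) :
    shiftSymbol n k * (shiftSymbol n k)ᴴ = 1 := by
  rw [shiftSymbol, fromBlocks_conjTranspose, fromBlocks_multiply, conjTranspose_smul,
    smul_mul_smul_comm, exp_I_mul_star]
  simp

theorem isMatrixChannel_period (N₁ N₂ : GaussianChannel (CellMode n)) (k : ℝ) :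
    IsMatrixChannel (periodB N₁ N₂ k) (periodA N₁ N₂ k) :=
  (N₂.isMatrixChannel.conj (shiftSymbol_mul_conjTranspose n k)).comp N₁.isMatrixChannel

/-- The operators on the cell modes of one period of the circuit form a channel pair. -/
theorem isChannelPair_period (N₁ N₂ : GaussianChannel (CellMode n)) (k : ℝ) :
    IsChannelPair (toEuclideanCLM (𝕜 := ℂ) (periodB N₁ N₂ k))
      (toEuclideanCLM (𝕜 := ℂ) (periodA N₁ N₂ k)) :=
  (isMatrixChannel_period N₁ N₂ k).isChannelPair

theorem steadyCorrelation_eq (N₁ N₂ : GaussianChannel (CellMode n)) (k : ℝ) :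
    steadyCorrelation N₁ N₂ k = steadyOn (toEuclideanCLM (𝕜 := ℂ) (periodB N₁ N₂ k))
      (toEuclideanCLM (𝕜 := ℂ) (periodA N₁ N₂ k)) := by
  rw [steadyOn, steadySum, ← compression_star, ← map_star]
  rfl

theorem tendsto_blockOn_momentumPeriod (N₁ N₂ : GaussianChannel (CellMode n)) (k : ℝ)
    (Γ₀ : Matrix (CellMode n) (CellMode n) ℂ) :
    Tendsto (fun t : ℕ =>
        blockOn (dissipativeSector N₁ N₂ k) ((momentumPeriod N₁ N₂ k)^[t] Γ₀))
      atTop (𝓝 (steadyCorrelation N₁ N₂ k)) := by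
  rw [steadyCorrelation_eq]
  refine (isChannelPair_period N₁ N₂ k).tendsto_compression_iterate
    (Γ := fun t => toEuclideanCLM (𝕜 := ℂ) ((momentumPeriod N₁ N₂ k)^[t] Γ₀)) fun t => ?_
  rw [Function.iterate_succ_apply', momentumPeriod, map_add, map_mul, map_mul,
    ← star_eq_conjTranspose, map_star]

theorem steadyEigenvalues_mem (N₁ N₂ : GaussianChannel (CellMode n)) (k : ℝ) :
    ∀ z ∈ steadyEigenvalues N₁ N₂ k, z.re = 0 ∧ z.im ∈ Set.Icc (-1 : ℝ) 1 := by
  intro z hz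
  rw [steadyEigenvalues, steadyCorrelation_eq] at hz
  have h := isChannelPair_period N₁ N₂ k
  have hz' := h.roots_charpoly_steadyOn ▸ hz
  obtain ⟨i, -, rfl⟩ := Multiset.mem_map.1 hz'
  simpa using h.levels_mem i

end Period

/-! ### Fourier transform of the circuit on a ring -/

section Ring

open Matrix

variable {n L : ℕ}

/-- The plane waves of momentum `k` on a ring of `L` cells, without normalization. -/
noncomputable def planeWave (n L : ℕ) (k : ℝ) : Matrix (CellMode n) (ZMod L × CellMode n) ℂ :=
  fun a p => if a = p.2 then Complex.exp (-(Complex.I * k)) ^ p.1.val else 0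

theorem star_exp_neg_pow_mul (k : ℝ) (m : ℕ) :
    Complex.exp (-(Complex.I * k)) ^ m * star (Complex.exp (-(Complex.I * k)) ^ m) = 1 := by
  rw [star_pow, ← mul_pow, ← star_exp_I_mul, star_star, mul_comm, exp_I_mul_star, one_pow]

variable [NeZero L]

theorem momentumBlock_eq (k : ℝ) (Γ : Matrix (ZMod L × CellMode n) (ZMod L × CellMode n) ℝ) :
    momentumBlock L k Γ =
      (1 / (L : ℂ)) • (planeWave n L k * complexify Γ * (planeWave n L k)ᴴ) := by
  ext a b
  have h : ∀ x y : ZMod L, Complex.exp (-Complex.I * k * ((x.val : ℂ) - (y.val : ℂ))) =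
      Complex.exp (-(Complex.I * k)) ^ x.val * star (Complex.exp (-(Complex.I * k)) ^ y.val) := by
    intro x y
    rw [star_pow, ← star_exp_I_mul, star_star, star_exp_I_mul, ← Complex.exp_nat_mul,
      ← Complex.exp_nat_mul, ← Complex.exp_add]
    congr 1
    ring
  simp only [momentumBlock, h, planeWave, Matrix.smul_apply, mul_apply, conjTranspose_apply,
    Fintype.sum_prod_type, complexify, map_apply, smul_eq_mul, ite_mul, zero_mul,
    Finset.sum_ite_eq, Finset.mem_univ, if_true, apply_ite star, star_zero, mul_ite, mul_zero]
  congr 1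
  rw [Finset.sum_comm]
  refine Finset.sum_congr rfl fun y _ => ?_
  rw [Finset.sum_mul]
  exact Finset.sum_congr rfl fun x _ => by ring

theorem planeWave_mul_oddLayer (k : ℝ) (M : Matrix (CellMode n) (CellMode n) ℝ) :
    planeWave n L k * complexify (oddLayer L M) = complexify M * planeWave n L k := by
  ext a ⟨y, b⟩
  simp only [planeWave, mul_apply, Fintype.sum_prod_type, complexify, map_apply, oddLayer, ite_mul,
    zero_mul, mul_ite, mul_zero, apply_ite Complex.ofReal, Complex.ofReal_zero]
  rw [Finset.sum_eq_single y (fun x _ hx => by simp [hx]) (by simp)]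
  simp [mul_comm]

theorem pow_val_add_one {z : ℂ} (hz : z ^ L = 1) (x : ZMod L) :
    z ^ (x + 1).val = z ^ x.val * z := by
  have h : x + 1 = ((x.val + 1 : ℕ) : ZMod L) := by simp
  rw [h, ZMod.val_natCast, ← pow_succ]
  conv_rhs => rw [← Nat.mod_add_div (x.val + 1) L, pow_add, pow_mul, hz, one_pow, mul_one]

/-- Translation by one site acts on plane waves by the shift symbol, up to a phase that cancels in
`evenSymbol`. -/
theorem planeWave_submatrix_siteShift {k : ℝ} (hk : Complex.exp (-(Complex.I * k)) ^ L = 1) :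
    (planeWave n L k).submatrix id (siteShift L n) =
      (Complex.exp (-(Complex.I * k)) • shiftSymbol n k) * planeWave n L k := by
  have h0 : Complex.exp (-(Complex.I * k)) * Complex.exp (Complex.I * k) = 1 := by
    rw [← Complex.exp_add, neg_add_cancel, Complex.exp_zero]
  ext a ⟨x, b⟩
  rcases a with a | a <;> rcases b with b | b
  · simp [planeWave, mul_apply, siteShift, shiftSymbol]
  · simp [planeWave, mul_apply, siteShift, shiftSymbol, pow_val_add_one hk, Matrix.one_apply]
    split_ifs <;> ring
  · simp [planeWave, mul_apply, siteShift, shiftSymbol, Matrix.one_apply, h0]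
  · simp [planeWave, mul_apply, siteShift, shiftSymbol]

theorem planeWave_mul_evenLayer {k : ℝ} (hk : Complex.exp (-(Complex.I * k)) ^ L = 1)
    (M : Matrix (CellMode n) (CellMode n) ℝ) :
    planeWave n L k * complexify (evenLayer L M) = evenSymbol M k * planeWave n L k := by
  set Φ := planeWave n L k
  set z := Complex.exp (-(Complex.I * k)) with hz
  set U := shiftSymbol n k with hU
  have hzz : z * star z = 1 := by simpa using star_exp_neg_pow_mul k 1
  have hUU : Uᴴ * U = 1 := mul_eq_one_comm.1 (shiftSymbol_mul_conjTranspose n k)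
  have h1 : Φ.submatrix id (siteShift L n) = (z • U) * Φ := planeWave_submatrix_siteShift hk
  have h2 : Φ.submatrix id (siteShift L n).symm = (star z • Uᴴ) * Φ := by
    have : Φ = (z • U) * Φ.submatrix id (siteShift L n).symm := by
      calc Φ = (Φ.submatrix id (siteShift L n)).submatrix id (siteShift L n).symm := by
            ext; simp
        _ = _ := by rw [h1]; rfl
    calc Φ.submatrix id (siteShift L n).symm
        = ((star z • Uᴴ) * (z • U)) * Φ.submatrix id (siteShift L n).symm := by
          rw [smul_mul_smul_comm, hUU, mul_comm, hzz, one_smul, Matrix.one_mul]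
      _ = _ := by rw [Matrix.mul_assoc, ← this]
  have h3 : complexify (evenLayer L M) =
      (complexify (oddLayer L M)).submatrix (siteShift L n).symm (siteShift L n).symm := rfl
  calc Φ * complexify (evenLayer L M)
      = ((Φ.submatrix id (siteShift L n)).submatrix id (siteShift L n).symm) *
          (complexify (oddLayer L M)).submatrix (siteShift L n).symm (siteShift L n).symm := by
        rw [h3]; congr 1; ext; simp
    _ = (Φ.submatrix id (siteShift L n) * complexify (oddLayer L M)).submatrix id
          (siteShift L n).symm := by rw [submatrix_mul_equiv]
    _ = (z • U) * complexify M * Φ.submatrix id (siteShift L n).symm := by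
        rw [h1, Matrix.mul_assoc, planeWave_mul_oddLayer, ← Matrix.mul_assoc]; rfl
    _ = evenSymbol M k * Φ := by
        rw [h2, evenSymbol, ← hU, ← Matrix.mul_assoc, smul_mul_assoc, smul_mul_assoc,
          mul_smul_comm, smul_smul, hzz, one_smul]

theorem planeWave_mul_conjTranspose (k : ℝ) :
    planeWave n L k * (planeWave n L k)ᴴ = (L : ℂ) • 1 := by
  ext a b
  simp only [planeWave, mul_apply, conjTranspose_apply, Fintype.sum_prod_type, ite_mul, zero_mul,
    Finset.sum_ite_eq, Finset.mem_univ, if_true, Matrix.smul_apply, Matrix.one_apply, smul_eq_mul]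
  by_cases h : a = b
  · subst h
    simp only [if_true, star_exp_neg_pow_mul, Finset.sum_const, Finset.card_univ, ZMod.card]
    simp
  · simp [h, Ne.symm h]

theorem complexify_add {ι : Type} (M N : Matrix ι ι ℝ) :
    complexify (M + N) = complexify M + complexify N := by
  ext; simp [complexify]

theorem momentumBlock_add (k : ℝ) (X Y : Matrix (ZMod L × CellMode n) (ZMod L × CellMode n) ℝ) :
    momentumBlock L k (X + Y) = momentumBlock L k X + momentumBlock L k Y := by
  simp only [momentumBlock_eq, complexify_add, Matrix.mul_add, Matrix.add_mul, smul_add]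

theorem momentumBlock_layer {k : ℝ} {X : Matrix (ZMod L × CellMode n) (ZMod L × CellMode n) ℝ}
    {S : Matrix (CellMode n) (CellMode n) ℂ}
    (h : planeWave n L k * complexify X = S * planeWave n L k) : momentumBlock L k X = S := by
  rw [momentumBlock_eq, h, Matrix.mul_assoc, planeWave_mul_conjTranspose, mul_smul_comm, smul_smul,
    one_div, inv_mul_cancel₀ (by exact_mod_cast NeZero.ne L), one_smul, Matrix.mul_one]

theorem momentumBlock_conj {k : ℝ} {X : Matrix (ZMod L × CellMode n) (ZMod L × CellMode n) ℝ}
    {S : Matrix (CellMode n) (CellMode n) ℂ}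
    (h : planeWave n L k * complexify X = S * planeWave n L k)
    (Y : Matrix (ZMod L × CellMode n) (ZMod L × CellMode n) ℝ) :
    momentumBlock L k (X * Y * X.transpose) = S * momentumBlock L k Y * Sᴴ := by
  have h' := congrArg conjTranspose h
  rw [conjTranspose_mul, conjTranspose_mul] at h'
  rw [momentumBlock_eq, momentumBlock_eq, complexify_mul, complexify_mul,
    ← complexify_conjTranspose, mul_smul_comm, smul_mul_assoc]
  congr 1
  calc _ = (planeWave n L k * complexify X) * complexify Y *
        ((complexify X)ᴴ * (planeWave n L k)ᴴ) := by simp only [Matrix.mul_assoc]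
    _ = _ := by rw [h, h']; simp only [Matrix.mul_assoc]

theorem momentumBlock_ringPeriod (N₁ N₂ : GaussianChannel (CellMode n)) {k : ℝ}
    (hk : Complex.exp (-(Complex.I * k)) ^ L = 1)
    (Γ : Matrix (ZMod L × CellMode n) (ZMod L × CellMode n) ℝ) :
    momentumBlock L k (ringPeriod L N₁ N₂ Γ) =
      momentumPeriod N₁ N₂ k (momentumBlock L k Γ) := by
  rw [ringPeriod, momentumBlock_add, momentumBlock_layer (planeWave_mul_evenLayer hk _),
    momentumBlock_conj (planeWave_mul_evenLayer hk _), momentumBlock_add,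
    momentumBlock_layer (planeWave_mul_oddLayer k _),
    momentumBlock_conj (planeWave_mul_oddLayer k _), momentumPeriod, periodA, periodB,
    conjTranspose_mul, Matrix.mul_add, Matrix.add_mul, add_assoc]
  simp only [Matrix.mul_assoc]

theorem exp_pow_eq_one (L : ℕ) [NeZero L] (m : ℤ) :
    Complex.exp (-(Complex.I * ((2 * Real.pi * m / L : ℝ) : ℂ))) ^ L = 1 := by
  have hL : (L : ℂ) ≠ 0 := by exact_mod_cast NeZero.ne L
  rw [← Complex.exp_nat_mul, Complex.exp_eq_one_iff]
  refine ⟨-m, ?_⟩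
  push_cast
  field_simp

theorem tendsto_blockOn_ringPeriod (N₁ N₂ : GaussianChannel (CellMode n)) (L : ℕ) [NeZero L]
    (m : ℤ) (Γ₀ : Matrix (ZMod L × CellMode n) (ZMod L × CellMode n) ℝ) :
    Tendsto (fun t : ℕ =>
        blockOn (dissipativeSector N₁ N₂ (2 * Real.pi * m / L))
          (momentumBlock L (2 * Real.pi * m / L) ((ringPeriod L N₁ N₂)^[t] Γ₀)))
      atTop (𝓝 (steadyCorrelation N₁ N₂ (2 * Real.pi * m / L))) := by
  refine (tendsto_blockOn_momentumPeriod N₁ N₂ (2 * Real.pi * m / L)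
    (momentumBlock L (2 * Real.pi * m / L) Γ₀)).congr fun t => ?_
  have h : Function.Semiconj (momentumBlock L (2 * Real.pi * m / L)) (ringPeriod L N₁ N₂)
      (momentumPeriod N₁ N₂ (2 * Real.pi * m / L)) := fun Γ =>
    momentumBlock_ringPeriod N₁ N₂ (exp_pow_eq_one L m) Γ
  rw [(h.iterate_right t).eq]

end Ring

/-! ### Periodic real-analytic functions of momentum -/

section Analytic

/-- The algebra of real-analytic complex-valued functions of momentum with period `2 π`. -/
def analyticPeriodic : Subalgebra ℂ (ℝ → ℂ) where
  carrier := {f | (∀ k, AnalyticAt ℝ f k) ∧ Function.Periodic f (2 * Real.pi)}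
  mul_mem' ha hb := ⟨fun k => (ha.1 k).mul (hb.1 k), ha.2.mul hb.2⟩
  add_mem' ha hb := ⟨fun k => (ha.1 k).add (hb.1 k), ha.2.add hb.2⟩
  algebraMap_mem' _ := ⟨fun _ => analyticAt_const, fun _ => rfl⟩

theorem exp_mem_analyticPeriodic :
    (fun k : ℝ => Complex.exp (Complex.I * k)) ∈ analyticPeriodic := by
  refine ⟨fun k => ?_, fun k => ?_⟩
  · have h1 : AnalyticAt ℝ (fun k : ℝ => Complex.I * (k : ℂ)) k :=
      analyticAt_const.mul (Complex.ofRealCLM.analyticAt k)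
    exact (AnalyticAt.restrictScalars (𝕜 := ℝ) analyticAt_cexp).comp h1
  · push_cast
    rw [mul_add, show Complex.I * (2 * Real.pi) = 2 * Real.pi * Complex.I by ring,
      Complex.exp_periodic]

theorem star_mem_analyticPeriodic {f : ℝ → ℂ} (hf : f ∈ analyticPeriodic) :
    (fun k => star (f k)) ∈ analyticPeriodic :=
  ⟨fun k => (Complex.conjCLE.toContinuousLinearMap.analyticAt (f k)).comp (hf.1 k),
    fun k => congrArg star (hf.2 k)⟩

theorem continuous_of_mem_analyticPeriodic {f : ℝ → ℂ} (hf : f ∈ analyticPeriodic) :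
    Continuous f :=
  continuous_iff_continuousAt.2 fun k => (hf.1 k).continuousAt

theorem eventually_ne_zero_of_mem {g : ℝ → ℂ} (hg : g ∈ analyticPeriodic) (h0 : g ≠ 0) (k₀ : ℝ) :
    ∀ᶠ k in 𝓝[≠] k₀, g k ≠ 0 := by
  refine (hg.1 k₀).eventually_eq_zero_or_eventually_ne_zero.resolve_left fun h => h0 ?_
  exact AnalyticOnNhd.eq_of_eventuallyEq (z₀ := k₀) (fun k _ => hg.1 k)
    (fun _ _ => analyticAt_const) h

theorem finite_zeros {g : ℝ → ℂ} (hg : g ∈ analyticPeriodic) (h0 : g ≠ 0) :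
    {k ∈ Set.Ico 0 (2 * Real.pi) | g k = 0}.Finite := by
  by_contra hinf
  obtain ⟨x, -, hx⟩ := Set.Infinite.exists_accPt_of_subset_isCompact (K := Set.Icc 0 (2 * Real.pi))
    hinf isCompact_Icc fun k hk => Set.Ico_subset_Icc_self hk.1
  rw [accPt_iff_frequently_nhdsNE] at hx
  exact hx ((eventually_ne_zero_of_mem hg h0 x).mono fun k hk h => hk h.2)

/-- Riemann's removable singularity theorem at a point, for a quotient of analytic functions. -/
theorem exists_analyticAt_of_bounded {f g F : ℝ → ℂ} {k₀ C : ℝ} (hf : AnalyticAt ℝ f k₀)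
    (hg : AnalyticAt ℝ g k₀) (h0 : ∀ᶠ k in 𝓝[≠] k₀, g k ≠ 0) (hF : ∀ k, ‖F k‖ ≤ C)
    (h : ∀ k, g k * F k = f k) :
    ∃ φ : ℝ → ℂ, AnalyticAt ℝ φ k₀ ∧ ∀ᶠ k in 𝓝[≠] k₀, φ k = F k := by
  obtain ⟨m, g₁, hg₁, hg₁0, hgm⟩ := hg.exists_eventuallyEq_pow_smul_nonzero_iff.2 fun h1 =>
    ((h1.filter_mono nhdsWithin_le_nhds).and h0).exists.elim fun _ hk => hk.2 hk.1
  by_cases hf0 : ∀ᶠ k in 𝓝 k₀, f k = 0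
  · refine ⟨0, analyticAt_const, ?_⟩
    filter_upwards [h0, hf0.filter_mono nhdsWithin_le_nhds] with k hk hfk
    have := h k
    rw [hfk] at this
    exact ((mul_eq_zero.1 this).resolve_left hk).symm
  obtain ⟨l, f₁, hf₁, hf₁0, hfl⟩ := hf.exists_eventuallyEq_pow_smul_nonzero_iff.2 hf0
  have hg₁e : ∀ᶠ k in 𝓝 k₀, g₁ k ≠ 0 := hg₁.continuousAt.eventually_ne hg₁0
  have hne : ∀ᶠ k in 𝓝[≠] k₀, ((k - k₀ : ℝ) : ℂ) ≠ 0 := by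
    filter_upwards [self_mem_nhdsWithin] with k hk
    exact_mod_cast sub_ne_zero.2 hk
  have hlin : AnalyticAt ℝ (fun k : ℝ => ((k - k₀ : ℝ) : ℂ)) k₀ :=
    (Complex.ofRealCLM.analyticAt _).comp (analyticAt_id.sub analyticAt_const)
  rcases le_or_gt m l with hml | hml
  · refine ⟨fun k => ((k - k₀ : ℝ) : ℂ) ^ (l - m) * f₁ k / g₁ k,
      ((hlin.pow _).mul hf₁).div hg₁ hg₁0, ?_⟩
    filter_upwards [hne, hg₁e.filter_mono nhdsWithin_le_nhds, hfl.filter_mono nhdsWithin_le_nhds,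
      hgm.filter_mono nhdsWithin_le_nhds] with k hk h1 h2 h3
    have h4 := h k
    rw [h2, h3, Complex.real_smul, Complex.real_smul] at h4
    push_cast at h4 hk ⊢
    rw [div_eq_iff h1]
    refine mul_left_cancel₀ (pow_ne_zero m hk) ?_
    rw [← mul_assoc, ← pow_add, Nat.add_sub_cancel' hml, ← h4]
    ring
  · exfalso
    -- `f₁ = (k - k₀) ^ (m - l) g₁ F` would tend to zero at `k₀`.
    have h1 : ∀ᶠ k in 𝓝[≠] k₀, ((k - k₀ : ℝ) : ℂ) ^ (m - l) * g₁ k * F k = f₁ k := by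
      filter_upwards [hne, hfl.filter_mono nhdsWithin_le_nhds,
        hgm.filter_mono nhdsWithin_le_nhds] with k hk h2 h3
      have h4 := h k
      rw [h2, h3, Complex.real_smul, Complex.real_smul] at h4
      push_cast at h4 hk ⊢
      refine mul_left_cancel₀ (pow_ne_zero l hk) ?_
      rw [← h4, ← mul_assoc, ← mul_assoc, ← pow_add, Nat.add_sub_cancel' hml.le]
    have h2 : Tendsto (fun k : ℝ => ((k - k₀ : ℝ) : ℂ) ^ (m - l) * g₁ k) (𝓝[≠] k₀) (𝓝 0) := by
      have := ((hlin.pow (m - l)).mul hg₁).continuousAt.tendsto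
      simp only [Pi.mul_apply, Pi.pow_apply, sub_self, Complex.ofReal_zero,
        zero_pow (Nat.sub_pos_of_lt hml).ne', zero_mul] at this
      exact this.mono_left nhdsWithin_le_nhds
    have h3 : Tendsto (fun k : ℝ => ((k - k₀ : ℝ) : ℂ) ^ (m - l) * g₁ k * F k) (𝓝[≠] k₀) (𝓝 0) :=
      h2.zero_mul_isBoundedUnder_le (isBoundedUnder_of ⟨C, fun k => hF k⟩)
    exact hf₁0 (tendsto_nhds_unique (hf₁.continuousAt.tendsto.mono_left nhdsWithin_le_nhds)
      (h3.congr' h1))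

/-- A bounded quotient of two functions in `analyticPeriodic` extends to a function in
`analyticPeriodic`. -/
theorem exists_mem_analyticPeriodic_of_bounded {f g F : ℝ → ℂ} {C : ℝ} (hf : f ∈ analyticPeriodic)
    (hg : g ∈ analyticPeriodic) (h0 : g ≠ 0) (hF : ∀ k, ‖F k‖ ≤ C) (h : ∀ k, g k * F k = f k) :
    ∃ φ ∈ analyticPeriodic, ∀ k, g k ≠ 0 → φ k = F k := by
  choose ψ hψ hψF using fun k₀ => exists_analyticAt_of_bounded (hf.1 k₀) (hg.1 k₀)
    (eventually_ne_zero_of_mem hg h0 k₀) hF h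
  set φ : ℝ → ℂ := fun k => ψ k k with hφ
  have hlim : ∀ k, Tendsto F (𝓝[≠] k) (𝓝 (φ k)) := fun k =>
    ((hψ k).continuousAt.tendsto.mono_left nhdsWithin_le_nhds).congr' (hψF k)
  have hloc : ∀ k₀, φ =ᶠ[𝓝 k₀] ψ k₀ := by
    intro k₀
    have h1 := (hψ k₀).eventually_analyticAt
    have h2 : ∀ᶠ k in 𝓝 k₀, k ≠ k₀ → ∀ᶠ x in 𝓝 k, ψ k₀ x = F x := by
      have := eventually_eventually_nhdsWithin.2 (hψF k₀)
      rw [eventually_nhdsWithin_iff] at this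
      filter_upwards [this] with k hk hne
      have h3 := hk hne
      rwa [isOpen_compl_singleton.nhdsWithin_eq hne] at h3
    filter_upwards [h1, h2] with k hk hk2
    rcases eq_or_ne k k₀ with rfl | hne
    · rfl
    · refine tendsto_nhds_unique (hlim k) ?_
      exact (hk.continuousAt.tendsto.mono_left nhdsWithin_le_nhds).congr'
        ((hk2 hne).filter_mono nhdsWithin_le_nhds)
  have hana : ∀ k, AnalyticAt ℝ φ k := fun k => (hψ k).congr (hloc k).symm
  have hval : ∀ k, g k ≠ 0 → φ k = F k := by
    intro k hk
    refine tendsto_nhds_unique (hlim k) ?_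
    have h1 : ContinuousAt (fun x => f x / g x) k :=
      (hf.1 k).continuousAt.div (hg.1 k).continuousAt hk
    have h2 : ∀ x, g x ≠ 0 → f x / g x = F x := fun x hx => by
      rw [div_eq_iff hx, ← h x, mul_comm]
    rw [← h2 k hk]
    refine (h1.tendsto.mono_left nhdsWithin_le_nhds).congr' ?_
    filter_upwards [eventually_ne_zero_of_mem hg h0 k] with x hx using h2 x hx
  refine ⟨φ, ⟨hana, fun k => ?_⟩, hval⟩
  -- `φ` and its translate agree off the zeros of `g`, so they agree by continuity.
  have h1 : Tendsto (fun x => φ (x + 2 * Real.pi)) (𝓝[≠] k) (𝓝 (φ (k + 2 * Real.pi))) := by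
    refine Tendsto.mono_left ?_ nhdsWithin_le_nhds
    exact ((hana (k + 2 * Real.pi)).continuousAt.tendsto.comp
      ((continuous_id.add continuous_const).tendsto k))
  refine tendsto_nhds_unique h1 ?_
  refine ((hana k).continuousAt.tendsto.mono_left nhdsWithin_le_nhds).congr' ?_
  filter_upwards [eventually_ne_zero_of_mem hg h0 k] with x hx
  have hx' : g (x + 2 * Real.pi) ≠ 0 := by rwa [hg.2 x]
  rw [hval x hx, hval _ hx']
  refine mul_left_cancel₀ hx ?_
  rw [h x, ← hf.2 x, ← h (x + 2 * Real.pi), hg.2 x]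

end Analytic

/-! ### Steady states are rational in the symbols of the circuit -/

section Cramer

open Polynomial Matrix

/-- Cancelling the common power `s ^ m` in `q s * G s = p s` at `s = 0`. -/
theorem coeff_mul_eq_of_eval_mul {G : ℝ → ℂ} {G₀ : ℂ} (hG : Tendsto G (𝓝[>] 0) (𝓝 G₀)) (m : ℕ) :
    ∀ p q : ℂ[X], (∀ i < m, q.coeff i = 0) →
      (∀ᶠ s : ℝ in 𝓝[>] 0, q.eval (s : ℂ) * G s = p.eval (s : ℂ)) →
        q.coeff m * G₀ = p.coeff m := by
  have hev : ∀ p : ℂ[X], Tendsto (fun s : ℝ => p.eval (s : ℂ)) (𝓝[>] 0) (𝓝 (p.coeff 0)) := by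
    intro p
    have : Continuous fun s : ℝ => p.eval (s : ℂ) := p.continuous.comp Complex.continuous_ofReal
    have h := this.tendsto 0
    rw [Complex.ofReal_zero, ← coeff_zero_eq_eval_zero] at h
    exact h.mono_left nhdsWithin_le_nhds
  have hlim : ∀ p q : ℂ[X], (∀ᶠ s : ℝ in 𝓝[>] 0, q.eval (s : ℂ) * G s = p.eval (s : ℂ)) →
      q.coeff 0 * G₀ = p.coeff 0 := fun p q h =>
    tendsto_nhds_unique ((hev q).mul hG) ((hev p).congr' (h.mono fun _ hs => hs.symm))
  induction m with
  | zero => exact fun p q _ h => hlim p q h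
  | succ m ih =>
    intro p q hq h
    have hq0 := hq 0 (Nat.succ_pos m)
    have hp0 : p.coeff 0 = 0 := by rw [← hlim p q h, hq0, zero_mul]
    rw [← coeff_divX, ← coeff_divX]
    refine ih _ _ (fun i hi => ?_) ?_
    · rw [coeff_divX]; exact hq _ (Nat.succ_lt_succ hi)
    · filter_upwards [h, self_mem_nhdsWithin] with s hs hs0
      have hs0' : (s : ℂ) ≠ 0 := by exact_mod_cast (ne_of_gt hs0)
      rw [← divX_mul_X_add q, ← divX_mul_X_add p, hq0, hp0] at hs
      simp only [map_zero, add_zero, eval_mul, eval_X] at hs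
      refine mul_right_cancel₀ hs0' ?_
      rw [← hs]; ring

theorem map_det_mul_eq_map_adjugate_mulVec {R κ : Type*} [CommRing R] [Fintype κ] [DecidableEq κ]
    (φ : R →+* ℂ) (M : Matrix κ κ R) (c : κ → R) {g : κ → ℂ}
    (h : ∀ a, ∑ b, φ (M a b) * g b = φ (c a)) (a : κ) :
    φ M.det * g a = φ ((M.adjugate *ᵥ c) a) := by
  have h1 : φ.mapMatrix M *ᵥ g = φ ∘ c := funext h
  have h2 : φ ((M.adjugate *ᵥ c) a) = ((φ.mapMatrix M).adjugate *ᵥ (φ ∘ c)) a := by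
    rw [RingHom.map_mulVec, ← RingHom.map_adjugate]
    rfl
  rw [h2, ← h1, mulVec_mulVec, adjugate_mul, smul_mulVec, one_mulVec, RingHom.map_det]
  rfl

theorem map_one_sub_smul_map_C {R κ : Type*} [CommRing R] [DecidableEq κ] (φ : R[X] →+* ℂ)
    (T : Matrix κ κ R) (a b : κ) :
    φ ((1 - (1 - X : R[X]) • T.map Polynomial.C : Matrix κ κ R[X]) a b) =
      (1 : Matrix κ κ ℂ) a b - (1 - φ X) * φ (Polynomial.C (T a b)) := by
  rw [Matrix.sub_apply, Matrix.smul_apply, map_apply, smul_eq_mul, map_sub, map_mul, map_sub,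
    map_one, Matrix.one_apply, Matrix.one_apply, apply_ite φ, map_one, map_zero]

variable {ι : Type} [Fintype ι] [DecidableEq ι]

/-- The value at momentum `k`, as a homomorphism. -/
def momentumEval (k : ℝ) : analyticPeriodic →+* ℂ :=
  (Pi.evalRingHom _ k).comp analyticPeriodic.val.toRingHom

/-- Solutions of `G = C + r B G B†` that are continuous in `r` have at `r = 1` entries with a common
analytic denominator: by Cramer's rule over polynomials in `s = 1 - r` with coefficients in
`analyticPeriodic`, the denominator being the lowest coefficient of the determinant. -/
theorem exists_common_denominator {B C : ℝ → Matrix ι ι ℂ} {G : ℝ → ℝ → Matrix ι ι ℂ}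
    (hB : ∀ i j, (fun k => B k i j) ∈ analyticPeriodic)
    (hC : ∀ i j, (fun k => C k i j) ∈ analyticPeriodic)
    (hG : ∀ k i j, ContinuousOn (fun r => G k r i j) (Set.Icc 0 1))
    (h : ∀ k, ∀ r ∈ Set.Icc (0 : ℝ) 1, G k r = C k + (r : ℂ) • (B k * G k r * (B k)ᴴ)) :
    ∃ q ∈ analyticPeriodic, q ≠ 0 ∧
      ∀ i j, ∃ p ∈ analyticPeriodic, ∀ k, q k * G k 1 i j = p k := by
  set T : Matrix (ι × ι) (ι × ι) analyticPeriodic := fun a b =>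
    ⟨fun k => B k a.1 b.1, hB _ _⟩ *
      ⟨fun k => star (B k a.2 b.2), star_mem_analyticPeriodic (hB _ _)⟩
  set M : Matrix (ι × ι) (ι × ι) analyticPeriodic[X] :=
    1 - (1 - X : analyticPeriodic[X]) • T.map Polynomial.C
  set c : ι × ι → analyticPeriodic := fun a => ⟨fun k => C k a.1 a.2, hC _ _⟩
  set P : ι × ι → analyticPeriodic[X] := M.adjugate *ᵥ fun a => Polynomial.C (c a)
  set φ : ℝ → ℝ → analyticPeriodic[X] →+* ℂ := fun k s => eval₂RingHom (momentumEval k) (s : ℂ)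
  have hM : ∀ k s a b, φ k s (M a b) = (1 : Matrix (ι × ι) (ι × ι) ℂ) a b -
      (1 - s) * (B k a.1 b.1 * star (B k a.2 b.2)) := by
    intro k s a b
    have hT : φ k s (Polynomial.C (T a b)) = B k a.1 b.1 * star (B k a.2 b.2) := eval₂_C _ _
    have hX : φ k s X = s := eval₂_X _ _
    rw [← hT, ← hX]
    exact map_one_sub_smul_map_C (φ k s) T a b
  have hsolve : ∀ k, ∀ s ∈ Set.Icc (0 : ℝ) 1, ∀ a : ι × ι,
      φ k s M.det * G k (1 - s) a.1 a.2 = φ k s (P a) := by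
    intro k s hs a
    refine map_det_mul_eq_map_adjugate_mulVec (φ k s) M (fun b => Polynomial.C (c b))
      (g := fun b => G k (1 - s) b.1 b.2) (fun b => ?_) a
    have hc : φ k s (Polynomial.C (c b)) = C k b.1 b.2 := eval₂_C _ _
    have h2 := congrFun (congrFun (h k (1 - s) ⟨by linarith [hs.2], by linarith [hs.1]⟩) b.1) b.2
    rw [Matrix.add_apply, Matrix.smul_apply, smul_eq_mul, ← sub_eq_iff_eq_add] at h2
    rw [hc, ← h2]
    simp only [hM, sub_mul, Finset.sum_sub_distrib, Matrix.one_apply, ite_mul, one_mul, zero_mul,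
      Finset.sum_ite_eq, Finset.mem_univ, if_true]
    rw [← Finset.sum_sub_distrib, mul_apply, Finset.mul_sum, Fintype.sum_prod_type_right]
    congr 1
    refine Finset.sum_congr rfl fun y _ => ?_
    rw [mul_apply, Finset.sum_mul, Finset.mul_sum]
    refine Finset.sum_congr rfl fun x _ => ?_
    rw [conjTranspose_apply]
    push_cast
    ring
  have hdet : M.det ≠ 0 := by
    intro h0
    have h1 : φ 0 1 M.det = 1 := by
      have h2 : (φ 0 1).mapMatrix M = 1 := by
        ext a b
        refine (hM 0 1 a b).trans ?_
        simp
      exact ((φ 0 1).map_det M).trans (h2 ▸ Matrix.det_one)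
    rw [h0, map_zero] at h1
    exact zero_ne_one h1
  refine ⟨_, M.det.trailingCoeff.2, fun h0 => hdet ?_, fun i j =>
    ⟨_, ((P (i, j)).coeff M.det.natTrailingDegree).2, fun k => ?_⟩⟩
  · exact trailingCoeff_eq_zero.1 (Subtype.ext h0)
  · have hlim : Tendsto (fun s : ℝ => G k (1 - s) i j) (𝓝[>] 0) (𝓝 (G k 1 i j)) := by
      refine (hG k i j 1 ⟨zero_le_one, le_rfl⟩).tendsto.comp (tendsto_nhdsWithin_iff.2 ⟨?_, ?_⟩)
      · have : Continuous fun s : ℝ => 1 - s := by fun_prop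
        have h1 := this.tendsto 0
        rw [sub_zero] at h1
        exact h1.mono_left nhdsWithin_le_nhds
      · filter_upwards [Ioc_mem_nhdsGT one_pos] with s hs
        exact ⟨by linarith [hs.2], by linarith [hs.1]⟩
    have := coeff_mul_eq_of_eval_mul hlim M.det.natTrailingDegree
      ((P (i, j)).map (momentumEval k)) (M.det.map (momentumEval k)) (fun l hl => ?_) ?_
    · rwa [coeff_map, coeff_map] at this
    · rw [coeff_map, coeff_eq_zero_of_lt_natTrailingDegree hl, map_zero]
    · have : Set.Ioc (0 : ℝ) 1 ∈ 𝓝[>] (0 : ℝ) := Ioc_mem_nhdsGT one_pos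
      filter_upwards [this] with s hs
      rw [eval_map, eval_map]
      exact hsolve k s ⟨hs.1.le, hs.2⟩ (i, j)

end Cramer

/-! ### Analytic families of matrices -/

section AnalyticMatrix

open Matrix

variable {ι : Type}

/-- A family of matrices whose entries are periodic real-analytic functions of momentum. -/
def IsAnalyticFamily {κ : Type} (M : ℝ → Matrix ι κ ℂ) : Prop :=
  ∀ i j, (fun k => M k i j) ∈ analyticPeriodic

namespace IsAnalyticFamily

theorem const (M : Matrix ι ι ℂ) : IsAnalyticFamily fun _ => M := fun i j =>
  analyticPeriodic.algebraMap_mem (M i j)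

theorem add {M N : ℝ → Matrix ι ι ℂ} (hM : IsAnalyticFamily M) (hN : IsAnalyticFamily N) :
    IsAnalyticFamily fun k => M k + N k := fun i j => analyticPeriodic.add_mem (hM i j) (hN i j)

theorem sub {M N : ℝ → Matrix ι ι ℂ} (hM : IsAnalyticFamily M) (hN : IsAnalyticFamily N) :
    IsAnalyticFamily fun k => M k - N k := fun i j => analyticPeriodic.sub_mem (hM i j) (hN i j)

theorem smul (c : ℂ) {M : ℝ → Matrix ι ι ℂ} (hM : IsAnalyticFamily M) :
    IsAnalyticFamily fun k => c • M k := fun i j => analyticPeriodic.smul_mem (hM i j) c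

theorem conjTranspose {M : ℝ → Matrix ι ι ℂ} (hM : IsAnalyticFamily M) :
    IsAnalyticFamily fun k => (M k)ᴴ := fun i j => star_mem_analyticPeriodic (hM j i)

theorem mul [Fintype ι] {M N : ℝ → Matrix ι ι ℂ} (hM : IsAnalyticFamily M)
    (hN : IsAnalyticFamily N) : IsAnalyticFamily fun k => M k * N k := by
  intro i j
  have h : (fun k => (M k * N k) i j) = ∑ l, (fun k => M k i l) * fun k => N k l j := by
    ext k
    simp [mul_apply]
  rw [h]
  exact analyticPeriodic.sum_mem fun l _ => analyticPeriodic.mul_mem (hM i l) (hN l j)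

theorem continuous {M : ℝ → Matrix ι ι ℂ} (hM : IsAnalyticFamily M) : Continuous M :=
  continuous_matrix fun i j => continuous_of_mem_analyticPeriodic (hM i j)

theorem periodic {M : ℝ → Matrix ι ι ℂ} (hM : IsAnalyticFamily M) :
    Function.Periodic M (2 * Real.pi) := fun k => by
  ext i j
  exact (hM i j).2 k

end IsAnalyticFamily

variable {n : ℕ}

theorem isAnalyticFamily_shiftSymbol (n : ℕ) : IsAnalyticFamily (shiftSymbol n) := by
  rintro (i | i) (j | j)
  · exact analyticPeriodic.zero_mem
  · exact analyticPeriodic.algebraMap_mem ((1 : Matrix (Fin n) (Fin n) ℂ) i j)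
  · have : (fun k => shiftSymbol n k (Sum.inr i) (Sum.inl j)) =
        (1 : Matrix (Fin n) (Fin n) ℂ) i j • fun k : ℝ => Complex.exp (Complex.I * k) := by
      ext k
      simp [shiftSymbol, mul_comm]
    rw [this]
    exact analyticPeriodic.smul_mem exp_mem_analyticPeriodic _
  · exact analyticPeriodic.zero_mem

theorem isAnalyticFamily_evenSymbol (M : Matrix (CellMode n) (CellMode n) ℝ) :
    IsAnalyticFamily (evenSymbol M) :=
  ((isAnalyticFamily_shiftSymbol n).mul (.const _)).mul
    (isAnalyticFamily_shiftSymbol n).conjTranspose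

theorem isAnalyticFamily_periodB (N₁ N₂ : GaussianChannel (CellMode n)) :
    IsAnalyticFamily (periodB N₁ N₂) :=
  (isAnalyticFamily_evenSymbol _).mul (.const _)

theorem isAnalyticFamily_periodA (N₁ N₂ : GaussianChannel (CellMode n)) :
    IsAnalyticFamily (periodA N₁ N₂) :=
  (isAnalyticFamily_evenSymbol _).add (((isAnalyticFamily_evenSymbol _).mul (.const _)).mul
    (isAnalyticFamily_evenSymbol _).conjTranspose)

theorem eq_of_eq_off_zeros {X : Type*} [TopologicalSpace X] [T2Space X] {f g : ℝ → X}
    (hf : Continuous f) (hg : Continuous g) {q : ℝ → ℂ} (hq : q ∈ analyticPeriodic) (hq0 : q ≠ 0)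
    (h : ∀ k, q k ≠ 0 → f k = g k) (k : ℝ) : f k = g k := by
  refine tendsto_nhds_unique ((hf.tendsto k).mono_left nhdsWithin_le_nhds)
    (((hg.tendsto k).mono_left (nhdsWithin_le_nhds (s := {k}ᶜ))).congr' ?_)
  filter_upwards [eventually_ne_zero_of_mem hq hq0 k] with x hx using (h x hx).symm

theorem mem_of_mem_off_zeros {X : Type*} [TopologicalSpace X] {f : ℝ → X} {Z : Set X}
    (hf : Continuous f) (hZ : IsClosed Z) {q : ℝ → ℂ} (hq : q ∈ analyticPeriodic) (hq0 : q ≠ 0)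
    (h : ∀ k, q k ≠ 0 → f k ∈ Z) (k : ℝ) : f k ∈ Z := by
  refine hZ.mem_of_tendsto ((hf.tendsto k).mono_left (nhdsWithin_le_nhds (s := {k}ᶜ))) ?_
  filter_upwards [eventually_ne_zero_of_mem hq hq0 k] with x hx using h x hx

/-- The shifted steady states extend to an analytic family over the whole Brillouin zone. -/
theorem exists_analytic_shiftedSteady (N₁ N₂ : GaussianChannel (CellMode n)) :
    ∃ q ∈ analyticPeriodic, q ≠ 0 ∧ ∃ M : ℝ → Matrix (CellMode n) (CellMode n) ℂ,
      IsAnalyticFamily M ∧ ∀ k, q k ≠ 0 → toEuclideanCLM (𝕜 := ℂ) (M k) =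
        shiftedSteady (toEuclideanCLM (𝕜 := ℂ) (periodB N₁ N₂ k))
          (toEuclideanCLM (𝕜 := ℂ) (periodA N₁ N₂ k)) := by
  choose G hGc hG1 hGeq using fun k => (isChannelPair_period N₁ N₂ k).exists_abel_family
  set B := periodB N₁ N₂
  set C : ℝ → Matrix (CellMode n) (CellMode n) ℂ := fun k =>
    (3 : ℂ) • (1 - B k * (B k)ᴴ) + -Complex.I • periodA N₁ N₂ k
  set e := toEuclideanCLM (𝕜 := ℂ) (n := CellMode n)
  have hB : IsAnalyticFamily B := isAnalyticFamily_periodB N₁ N₂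
  have hC : IsAnalyticFamily C :=
    (((IsAnalyticFamily.const 1).sub (hB.mul hB.conjTranspose)).smul 3).add
      ((isAnalyticFamily_periodA N₁ N₂).smul _)
  have hentry : ∀ (T : EuclideanSpace ℂ (CellMode n) →L[ℂ] EuclideanSpace ℂ (CellMode n)) i j,
      e.symm T i j = T (EuclideanSpace.single j 1) i := by
    intro T i j
    obtain ⟨M, rfl⟩ := EquivLike.surjective e T
    rw [StarAlgEquiv.symm_apply_apply]
    simp [e, EuclideanSpace.single]
  obtain ⟨q, hq, hq0, hqp⟩ := exists_common_denominator (G := fun k r => e.symm (G k r)) hB hC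
    (fun k i j => by
      simp only [hentry]
      have h1 : Continuous fun v : EuclideanSpace ℂ (CellMode n) => v i := by fun_prop
      exact h1.comp_continuousOn ((hGc k).clm_apply continuousOn_const))
    (fun k r hr => by
      refine EquivLike.injective e ?_
      have h1 := hGeq k r hr
      rw [← Complex.coe_smul r] at h1
      rw [map_add, map_smul, map_mul, map_mul, ← star_eq_conjTranspose, map_star,
        StarAlgEquiv.apply_symm_apply]
      convert h1 using 2
      simp only [C, shiftedNoise, map_add, map_smul, map_sub, map_one, map_mul,
        ← star_eq_conjTranspose, map_star, e, B])
  have hbound : ∀ k i j, ‖e.symm (G k 1) i j‖ ≤ 4 := by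
    intro k i j
    rw [hentry, hG1]
    refine (PiLp.norm_apply_le _ i).trans ?_
    refine (ContinuousLinearMap.le_opNorm _ _).trans ?_
    have h1 : ‖EuclideanSpace.single j (1 : ℂ)‖ = 1 := by simp
    rw [h1, mul_one]
    exact (isChannelPair_period N₁ N₂ k).norm_shiftedSteady_le
  choose p hp hpq using hqp
  choose M hM hMq using fun i j => exists_mem_analyticPeriodic_of_bounded (hp i j) hq hq0
    (fun k => hbound k i j) (hpq i j)
  refine ⟨q, hq, hq0, fun k => Matrix.of fun i j => M i j k, hM, fun k hk => ?_⟩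
  rw [← hG1 k, ← StarAlgEquiv.apply_symm_apply e (G k 1)]
  congr 1
  ext i j
  exact hMq i j k hk

open Polynomial in
/-- The multiplicity of a fixed eigenvalue of an analytic family is generically constant. -/
theorem IsAnalyticFamily.exists_rootMultiplicity_eq [Fintype ι] [DecidableEq ι]
    {M : ℝ → Matrix ι ι ℂ} (hM : IsAnalyticFamily M) (c : ℂ) :
    ∃ g ∈ analyticPeriodic, g ≠ 0 ∧ ∃ m : ℕ, ∀ k, g k ≠ 0 →
      (M k).charpoly.rootMultiplicity c = m := by
  set M' : Matrix ι ι analyticPeriodic := Matrix.of fun i j => ⟨fun k => M k i j, hM i j⟩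
  set c' : analyticPeriodic := algebraMap ℂ _ c
  set P : analyticPeriodic[X] := M'.charpoly.comp (X + C c')
  have hP : P ≠ 0 := ((Matrix.charpoly_monic M').comp_X_add_C c').ne_zero
  have hmap : ∀ k, P.map (momentumEval k) = (M k).charpoly.comp (X + C c) := by
    intro k
    have h1 : (momentumEval k).mapMatrix M' = M k := by ext; rfl
    have h2 : momentumEval k c' = c := rfl
    rw [← h1, RingHom.mapMatrix_apply, Matrix.charpoly_map, Polynomial.map_comp, Polynomial.map_add,
      map_X, map_C, h2]
  refine ⟨_, P.trailingCoeff.2, fun h => hP (trailingCoeff_eq_zero.1 (Subtype.ext h)),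
    P.natTrailingDegree, fun k hk => ?_⟩
  rw [rootMultiplicity_eq_natTrailingDegree, ← hmap]
  refine le_antisymm (natTrailingDegree_le_of_ne_zero ?_) (le_natTrailingDegree ?_ ?_)
  · rw [coeff_map]; exact hk
  · intro h0
    apply hk
    have := congrArg (fun Q => Q.coeff P.natTrailingDegree) h0
    rwa [coeff_map, coeff_zero] at this
  · intro l hl
    rw [coeff_map, coeff_eq_zero_of_lt_natTrailingDegree hl, map_zero]

end AnalyticMatrix

/-! ### Continuity of ordered eigenvalues -/

section Weyl

variable {E : Type*} [NormedAddCommGroup E] [InnerProductSpace ℂ E] [FiniteDimensional ℂ E] {d : ℕ}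

theorem LinearMap.IsSymmetric.re_inner_eq_sum_eigenvalues {T : E →ₗ[ℂ] E} (hT : T.IsSymmetric)
    (hn : Module.finrank ℂ E = d) (v : E) :
    RCLike.re (inner ℂ (T v) v) =
      ∑ i, hT.eigenvalues hn i * ‖(hT.eigenvectorBasis hn).repr v i‖ ^ 2 := by
  rw [← (hT.eigenvectorBasis hn).repr.inner_map_map, PiLp.inner_apply, map_sum]
  refine Finset.sum_congr rfl fun i _ => ?_
  rw [hT.eigenvectorBasis_apply_self_apply, ← smul_eq_mul, inner_smul_left,
    inner_self_eq_norm_sq_to_K]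
  simp
  norm_cast
  exact Or.inl rfl

/-- Weyl's inequality: a nonzero vector without components along the eigenvectors of `S` before the
`j`-th and along those of `T` after the `j`-th compares the two `j`-th eigenvalues. -/
theorem LinearMap.IsSymmetric.eigenvalues_le_add {T S : E →ₗ[ℂ] E} (hT : T.IsSymmetric)
    (hS : S.IsSymmetric) (hn : Module.finrank ℂ E = d) {r : ℝ}
    (h : ∀ v, RCLike.re (inner ℂ (T v) v) ≤ RCLike.re (inner ℂ (S v) v) + r * ‖v‖ ^ 2) (j : Fin d) :
    hT.eigenvalues hn j ≤ hS.eigenvalues hn j + r := by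
  set b := hT.eigenvectorBasis hn with hb
  set c := hS.eigenvectorBasis hn with hc
  set φ : E →ₗ[ℂ] (Fin d → ℂ) := LinearMap.pi fun i =>
    if i < j then c.toBasis.coord i else if j < i then b.toBasis.coord i else 0 with hφ
  have hinj : ¬ Function.Injective φ := by
    intro hinj
    have hsurj := (LinearMap.injective_iff_surjective_of_finrank_eq_finrank
      (by rw [hn, Module.finrank_fin_fun])).1 hinj
    obtain ⟨v, hv⟩ := hsurj (Pi.single j 1)
    have := congrFun hv j
    simp [hφ] at this
  obtain ⟨v, hv, hv0⟩ : ∃ v, φ v = 0 ∧ v ≠ 0 := by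
    by_contra! hcon
    exact hinj ((injective_iff_map_eq_zero φ).2 hcon)
  have hcv : ∀ i < j, c.repr v i = 0 := by
    intro i hi
    have := congrFun hv i
    simpa [hφ, hi] using this
  have hbv : ∀ i, j < i → b.repr v i = 0 := by
    intro i hi
    have := congrFun hv i
    simpa [hφ, hi, hi.not_gt] using this
  have hnorm : ∀ a : OrthonormalBasis (Fin d) ℂ E, ‖v‖ ^ 2 = ∑ i, ‖a.repr v i‖ ^ 2 := by
    intro a
    rw [← a.repr.norm_map, EuclideanSpace.norm_sq_eq]
  have h1 : hT.eigenvalues hn j * ‖v‖ ^ 2 ≤ RCLike.re (inner ℂ (T v) v) := by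
    rw [hT.re_inner_eq_sum_eigenvalues hn, hnorm b, Finset.mul_sum]
    refine Finset.sum_le_sum fun i _ => ?_
    rcases le_or_gt i j with hij | hij
    · exact mul_le_mul_of_nonneg_right (hT.eigenvalues_antitone hn hij) (sq_nonneg _)
    · rw [hbv i hij]; simp
  have h2 : RCLike.re (inner ℂ (S v) v) ≤ hS.eigenvalues hn j * ‖v‖ ^ 2 := by
    rw [hS.re_inner_eq_sum_eigenvalues hn, hnorm c, Finset.mul_sum]
    refine Finset.sum_le_sum fun i _ => ?_
    rcases le_or_gt j i with hij | hij
    · exact mul_le_mul_of_nonneg_right (hS.eigenvalues_antitone hn hij) (sq_nonneg _)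
    · rw [hcv i hij]; simp
  have h3 : 0 < ‖v‖ ^ 2 := by positivity
  refine le_of_mul_le_mul_right ?_ h3
  rw [add_mul]
  linarith [h v]

theorem Matrix.IsHermitian.eigenvalues₀_le_add {ι : Type*} [Fintype ι] [DecidableEq ι]
    {M N : Matrix ι ι ℂ} (hM : M.IsHermitian) (hN : N.IsHermitian) (j : Fin (Fintype.card ι)) :
    hM.eigenvalues₀ j ≤ hN.eigenvalues₀ j + ‖Matrix.toEuclideanCLM (𝕜 := ℂ) (M - N)‖ := by
  refine LinearMap.IsSymmetric.eigenvalues_le_add _ _ _ (fun v => ?_) j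
  have h1 : Matrix.toEuclideanLin M v =
      Matrix.toEuclideanLin N v + Matrix.toEuclideanCLM (𝕜 := ℂ) (M - N) v := by
    rw [map_sub]
    simp [← Matrix.coe_toEuclideanCLM_eq_toEuclideanLin]
  rw [h1, inner_add_left, map_add]
  gcongr
  calc _ ≤ ‖inner ℂ (Matrix.toEuclideanCLM (𝕜 := ℂ) (M - N) v) v‖ := RCLike.re_le_norm _
    _ ≤ ‖Matrix.toEuclideanCLM (𝕜 := ℂ) (M - N) v‖ * ‖v‖ := norm_inner_le_norm _ _
    _ ≤ ‖Matrix.toEuclideanCLM (𝕜 := ℂ) (M - N)‖ * ‖v‖ * ‖v‖ := by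
      gcongr; exact ContinuousLinearMap.le_opNorm _ _
    _ = _ := by ring

theorem continuous_eigenvalues₀ {X ι : Type*} [TopologicalSpace X] [Fintype ι] [DecidableEq ι]
    {M : X → Matrix ι ι ℂ} (hc : Continuous M) (hM : ∀ x, (M x).IsHermitian)
    (j : Fin (Fintype.card ι)) : Continuous fun x => (hM x).eigenvalues₀ j := by
  have hcont : Continuous fun N : Matrix ι ι ℂ => Matrix.toEuclideanCLM (𝕜 := ℂ) N :=
    LinearMap.continuous_of_finiteDimensional
      (Matrix.toEuclideanCLM (𝕜 := ℂ) (n := ι)).toAlgEquiv.toLinearMap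
  rw [continuous_iff_continuousAt]
  intro x₀
  rw [ContinuousAt, tendsto_iff_dist_tendsto_zero]
  have h1 : Tendsto (fun x => ‖Matrix.toEuclideanCLM (𝕜 := ℂ) (M x - M x₀)‖) (𝓝 x₀) (𝓝 0) := by
    have : Continuous fun x => ‖Matrix.toEuclideanCLM (𝕜 := ℂ) (M x - M x₀)‖ :=
      (hcont.comp (hc.sub continuous_const)).norm
    have h2 := this.tendsto x₀
    rwa [sub_self, map_zero, norm_zero] at h2
  refine squeeze_zero (fun _ => dist_nonneg) (fun x => ?_) h1
  rw [Real.dist_eq, abs_sub_le_iff]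
  have h2 := (hM x).eigenvalues₀_le_add (hM x₀) j
  have h3 := (hM x₀).eigenvalues₀_le_add (hM x) j
  rw [← neg_sub (M x), map_neg, norm_neg] at h3
  constructor <;> linarith

end Weyl

/-! ### Flow of continuous periodic levels -/

section Flow

variable {D : ℕ} {ε : Fin D → ℝ → EReal}

open Classical in
/-- The number of levels above the energy `E`. -/
noncomputable def levelsAbove (ε : Fin D → ℝ → EReal) (E : EReal) (k : ℝ) : ℕ :=
  (Finset.univ.filter fun j => E < ε j k).card

/-- Where the number of levels at `E` is locally constant, no level crosses `E`: the numbers of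
levels above and below `E` are both lower semicontinuous, and their sum is locally constant. -/
theorem levelsAbove_eventually_eq (hε : ∀ j, Continuous (ε j)) {E : EReal} {m : ℕ} {k₀ : ℝ}
    (h : ∀ᶠ k in 𝓝 k₀, (Finset.univ.filter fun j => ε j k = E).card = m) :
    ∀ᶠ k in 𝓝 k₀, levelsAbove ε E k = levelsAbove ε E k₀ := by
  classical
  have htri : ∀ k, levelsAbove ε E k + (Finset.univ.filter fun j => ε j k < E).card +
      (Finset.univ.filter fun j => ε j k = E).card = D := by
    intro k
    have h1 := Finset.card_filter_add_card_filter_not (s := (Finset.univ : Finset (Fin D)))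
      fun j => E < ε j k
    have h2 := Finset.card_filter_add_card_filter_not
      (s := Finset.univ.filter fun j => ¬ E < ε j k) fun j => ε j k < E
    rw [Finset.filter_filter, Finset.filter_filter] at h2
    have h3 : (Finset.univ.filter fun j => ¬ E < ε j k ∧ ε j k < E) =
        Finset.univ.filter fun j => ε j k < E :=
      Finset.filter_congr fun j _ => ⟨fun h => h.2, fun h => ⟨h.not_gt, h⟩⟩
    have h4 : (Finset.univ.filter fun j => ¬ E < ε j k ∧ ¬ ε j k < E) =
        Finset.univ.filter fun j => ε j k = E :=
      Finset.filter_congr fun j _ =>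
        ⟨fun h => le_antisymm (not_lt.1 h.1) (not_lt.1 h.2), fun h => by simp [h]⟩
    rw [h3, h4] at h2
    rw [Finset.card_univ, Fintype.card_fin] at h1
    rw [levelsAbove, add_assoc, h2]
    convert h1
  have hup : ∀ᶠ k in 𝓝 k₀, ∀ j, E < ε j k₀ → E < ε j k :=
    eventually_all.2 fun j => by
      by_cases hj : E < ε j k₀
      · filter_upwards [(hε j).continuousAt.eventually (lt_mem_nhds hj)] with k hk _ using hk
      · exact Eventually.of_forall fun k h => absurd h hj
  have hdown : ∀ᶠ k in 𝓝 k₀, ∀ j, ε j k₀ < E → ε j k < E :=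
    eventually_all.2 fun j => by
      by_cases hj : ε j k₀ < E
      · filter_upwards [(hε j).continuousAt.eventually (gt_mem_nhds hj)] with k hk _ using hk
      · exact Eventually.of_forall fun k h => absurd h hj
  filter_upwards [h, hup, hdown] with k hk h1 h2
  have h3 : levelsAbove ε E k₀ ≤ levelsAbove ε E k :=
    Finset.card_le_card (Finset.monotone_filter_right _ fun j _ => h1 j)
  have h4 : (Finset.univ.filter fun j => ε j k₀ < E).card ≤
      (Finset.univ.filter fun j => ε j k < E).card :=
    Finset.card_le_card (Finset.monotone_filter_right _ fun j _ => h2 j)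
  have h5 := htri k
  have h6 := htri k₀
  have h7 := h.self_of_nhds
  omega

/-- The jumps of a periodic step function over one period cancel. -/
theorem sum_jumps_eq_zero {f fl fr : ℝ → ℤ} {p : ℝ} (hp : 0 < p)
    (hl : ∀ x, ∀ᶠ y in 𝓝[<] x, f y = fl x) (hr : ∀ x, ∀ᶠ y in 𝓝[>] x, f y = fr x)
    (hper : Function.Periodic fl p) (Z : Finset ℝ)
    (hZ : ∀ x, x ∈ Z ↔ x ∈ Set.Ico 0 p ∧ fr x - fl x ≠ 0) :
    ∑ x ∈ Z, (fr x - fl x) = 0 := by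
  classical
  have hfl : ∀ {x : ℝ} {s : Set ℝ} {c : ℤ}, IsOpen s → x ∈ s → (∀ y ∈ s, f y = c) → fl x = c := by
    intro x s c hs hx h
    obtain ⟨y, hy1, hy2⟩ :=
      ((hl x).and ((hs.mem_nhds hx : s ∈ 𝓝 x) |> mem_nhdsWithin_of_mem_nhds)).exists
    rw [← hy1, h y hy2]
  have hleft : ∀ x, ∀ᶠ y in 𝓝[<] x, fl y = fl x := by
    intro x
    obtain ⟨a, ha, h⟩ := (mem_nhdsLT_iff_exists_Ioo_subset).1 (hl x)
    filter_upwards [Ioo_mem_nhdsLT ha] with y hy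
    exact hfl isOpen_Ioo hy h
  have hright : ∀ x, ∀ᶠ y in 𝓝[>] x, fl y = fr x := by
    intro x
    obtain ⟨a, ha, h⟩ := (mem_nhdsGT_iff_exists_Ioo_subset).1 (hr x)
    filter_upwards [Ioo_mem_nhdsGT ha] with y hy
    exact hfl isOpen_Ioo hy h
  -- Subtracting from the step function the jumps passed so far leaves a continuous function.
  set H : ℝ → ℤ := fun x => fl x - ∑ z ∈ Z, if z < x then fr z - fl z else 0 with hH
  have hcont : ContinuousOn H (Set.Icc 0 p) := by
    intro x hx
    refine ContinuousWithinAt.congr_of_eventuallyEq (f := fun _ => H x)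
      continuousWithinAt_const ?_ rfl
    have h1 : ∀ᶠ y in 𝓝[<] x, H y = H x := by
      have hz : ∀ᶠ y in 𝓝[<] x, ∀ z ∈ Z, (z < y ↔ z < x) := by
        refine (Filter.eventually_all_finset Z).2 fun z _ => ?_
        rcases lt_or_ge z x with hzx | hzx
        · filter_upwards [Ioo_mem_nhdsLT hzx] with y hy using ⟨fun _ => hzx, fun _ => hy.1⟩
        · filter_upwards [self_mem_nhdsWithin] with y hy
          exact ⟨fun h => absurd (h.trans hy) (not_lt.2 hzx), fun h => absurd h (not_lt.2 hzx)⟩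
      filter_upwards [hz, hleft x] with y hy hy'
      rw [hH]
      simp only [hy']
      congr 1
      exact Finset.sum_congr rfl fun z hzZ => by simp only [hy z hzZ]
    have h2 : x < p → ∀ᶠ y in 𝓝[>] x, H y = H x := by
      intro hxp
      have hz : ∀ᶠ y in 𝓝[>] x, ∀ z ∈ Z, (z < y ↔ z ≤ x) := by
        refine (Filter.eventually_all_finset Z).2 fun z _ => ?_
        rcases le_or_gt z x with hzx | hzx
        · filter_upwards [self_mem_nhdsWithin] with y hy
          exact ⟨fun _ => hzx, fun _ => lt_of_le_of_lt hzx hy⟩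
        · filter_upwards [Ioo_mem_nhdsGT hzx] with y hy
          exact ⟨fun h => absurd (h.trans hy.2) (lt_irrefl _), fun h => absurd h (not_le.2 hzx)⟩
      filter_upwards [hz, hright x] with y hy hy'
      have h3 : ∑ z ∈ Z, (if z < y then fr z - fl z else 0) =
          ∑ z ∈ Z, (if z < x then fr z - fl z else 0) +
            ∑ z ∈ Z, if x = z then fr z - fl z else 0 := by
        rw [← Finset.sum_add_distrib]
        refine Finset.sum_congr rfl fun z hzZ => ?_
        rw [if_congr (hy z hzZ) rfl rfl]
        rcases lt_trichotomy z x with h | h | h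
        · simp [h, h.le, h.ne']
        · simp [h]
        · simp [h.not_ge, h.not_gt, h.ne]
      have h4 : ∑ z ∈ Z, (if x = z then fr z - fl z else 0) = fr x - fl x := by
        rw [Finset.sum_ite_eq]
        split_ifs with hxZ
        · rfl
        · by_contra hne
          exact hxZ ((hZ x).2 ⟨⟨hx.1, hxp⟩, fun h => hne h.symm⟩)
      simp only [hH, hy', h3, h4]
      ring
    rw [Filter.EventuallyEq, eventually_nhdsWithin_iff]
    have h1' := eventually_nhdsWithin_iff.1 h1
    rcases hx.2.lt_or_eq with hxp | hxp
    · filter_upwards [h1', eventually_nhdsWithin_iff.1 (h2 hxp)] with y hy1 hy2 _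
      rcases lt_trichotomy y x with h | h | h
      · exact hy1 h
      · rw [h]
      · exact hy2 h
    · filter_upwards [h1'] with y hy1 hy
      rcases (hxp ▸ hy.2 : y ≤ x).lt_or_eq with h | h
      · exact hy1 h
      · rw [h]
  have h0 := isPreconnected_Icc.constant hcont
    (Set.left_mem_Icc.2 hp.le) (Set.right_mem_Icc.2 hp.le)
  have hz0 : ∑ z ∈ Z, (if z < 0 then fr z - fl z else 0) = 0 :=
    Finset.sum_eq_zero fun z hzZ => if_neg (not_lt.2 ((hZ z).1 hzZ).1.1)
  have hzp : ∑ z ∈ Z, (if z < p then fr z - fl z else 0) = ∑ z ∈ Z, (fr z - fl z) :=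
    Finset.sum_congr rfl fun z hzZ => if_pos ((hZ z).1 hzZ).1.2
  have hpp : fl p = fl 0 := by simpa using hper 0
  simp only [hH, hz0, hzp, hpp] at h0
  linarith

/-- In a small window above `E`, next to `k₀`, lie exactly the levels above `E` except those that
are above `E` at `k₀` already. -/
theorem eventually_levelCount_eq (hε : ∀ j, Continuous (ε j)) {S : ℝ → Multiset EReal} {E k₀ : ℝ}
    (hS : ∀ᶠ k in 𝓝[≠] k₀, S k = Finset.univ.val.map fun j => ε j k) :
    ∀ᶠ δ in 𝓝[>] (0 : ℝ), ∀ᶠ k in 𝓝[≠] k₀,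
      (levelCount (S k) E (E + δ) : ℤ) = levelsAbove ε E k - levelsAbove ε E k₀ := by
  classical
  have hδ : ∀ᶠ δ in 𝓝[>] (0 : ℝ), ∀ j, (E : EReal) < ε j k₀ → ((E + δ : ℝ) : EReal) < ε j k₀ := by
    refine eventually_all.2 fun j => ?_
    by_cases hj : (E : EReal) < ε j k₀
    · have hc : Continuous fun δ : ℝ => ((E + δ : ℝ) : EReal) :=
        continuous_coe_real_ereal.comp (continuous_const.add continuous_id)
      have := (hc.tendsto 0).eventually (gt_mem_nhds (by rwa [add_zero]))
      filter_upwards [this.filter_mono nhdsWithin_le_nhds] with δ h _ using h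
    · exact Eventually.of_forall fun _ h => absurd h hj
  filter_upwards [hδ, self_mem_nhdsWithin] with δ hδ hδ0
  have hlt : (E : EReal) < ((E + δ : ℝ) : EReal) := by
    exact_mod_cast lt_add_of_pos_right E hδ0
  have hup : ∀ᶠ k in 𝓝 k₀, ∀ j, (E : EReal) < ε j k₀ → ((E + δ : ℝ) : EReal) < ε j k :=
    eventually_all.2 fun j => by
      by_cases hj : (E : EReal) < ε j k₀
      · filter_upwards [(hε j).continuousAt.eventually (lt_mem_nhds (hδ j hj))] with k hk _ using hk
      · exact Eventually.of_forall fun _ h => absurd h hj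
  have hdown : ∀ᶠ k in 𝓝 k₀, ∀ j, ¬ (E : EReal) < ε j k₀ → ε j k < ((E + δ : ℝ) : EReal) :=
    eventually_all.2 fun j => by
      by_cases hj : (E : EReal) < ε j k₀
      · exact Eventually.of_forall fun _ h => absurd hj h
      · filter_upwards [(hε j).continuousAt.eventually
          (gt_mem_nhds ((not_lt.1 hj).trans_lt hlt))] with k hk _ using hk
  filter_upwards [hS, hup.filter_mono nhdsWithin_le_nhds, hdown.filter_mono nhdsWithin_le_nhds]
    with k hk h1 h2
  have h3 : levelCount (S k) E (E + δ) =
      (Finset.univ.filter fun j => (E : EReal) < ε j k ∧ ¬ (E : EReal) < ε j k₀).card := by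
    rw [levelCount, hk, Multiset.filter_map, Multiset.card_map, Finset.card_def, Finset.filter_val]
    congr 1
    refine Multiset.filter_congr fun j _ => ?_
    simp only [Function.comp_apply]
    constructor
    · exact fun h => ⟨h.1, fun h' => absurd (h1 j h') h.2.not_gt⟩
    · exact fun h => ⟨h.1, h2 j h.2⟩
  have h4 := Finset.card_filter_add_card_filter_not
    (s := Finset.univ.filter fun j => (E : EReal) < ε j k) fun j => (E : EReal) < ε j k₀
  rw [Finset.filter_filter, Finset.filter_filter] at h4
  have h5 : (Finset.univ.filter fun j => (E : EReal) < ε j k ∧ (E : EReal) < ε j k₀) =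
      Finset.univ.filter fun j => (E : EReal) < ε j k₀ :=
    Finset.filter_congr fun j _ => ⟨fun h => h.2, fun h => ⟨hlt.trans (h1 j h), h⟩⟩
  rw [h5] at h4
  rw [h3, levelsAbove, levelsAbove]
  have h6 : ∀ a b c : ℕ, a + b = c → (b : ℤ) = c - a := by intro a b c h; omega
  refine h6 _ _ _ ?_
  convert h4

/-- Continuous periodic levels that meet each energy a generically constant number of times are
non-chiral. -/
theorem isNonChiral_of_bands (hε : ∀ j, Continuous (ε j))
    (hper : ∀ j, Function.Periodic (ε j) (2 * Real.pi)) {S : ℝ → Multiset EReal}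
    (hS : ∀ k₀, ∀ᶠ k in 𝓝[≠] k₀, S k = Finset.univ.val.map fun j => ε j k)
    (hE : ∀ E : ℝ, ∃ g ∈ analyticPeriodic, g ≠ 0 ∧ ∃ m : ℕ, ∀ k, g k ≠ 0 →
      (Finset.univ.filter fun j => ε j k = E).card = m) :
    IsNonChiral S := by
  intro E
  obtain ⟨g, hg, hg0, m, hm⟩ := hE E
  set N : ℝ → ℤ := fun k => levelsAbove ε E k with hN
  have hreg : ∀ k₀, g k₀ ≠ 0 → ∀ᶠ k in 𝓝 k₀, N k = N k₀ := by
    intro k₀ h0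
    have h1 : ∀ᶠ k in 𝓝 k₀, g k ≠ 0 :=
      (continuous_of_mem_analyticPeriodic hg).continuousAt.eventually_ne h0
    filter_upwards [levelsAbove_eventually_eq hε (h1.mono fun k hk => hm k hk)] with k hk
    simp only [hN, hk]
  have hconst : ∀ {s : Set ℝ}, IsPreconnected s → (∀ x ∈ s, g x ≠ 0) → ∀ x ∈ s, ∀ y ∈ s,
      N x = N y := fun hs h x hx y hy =>
    hs.constant (fun z hz => (continuousAt_const.congr
      ((hreg z (h z hz)).mono fun _ h => h.symm)).continuousWithinAt) hx hy
  have hne := fun k₀ => eventually_ne_zero_of_mem hg hg0 k₀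
  have hl : ∀ x, ∃ c, ∀ᶠ y in 𝓝[<] x, N y = c := by
    intro x
    obtain ⟨a, ha, h⟩ := (mem_nhdsLT_iff_exists_Ioo_subset).1
      ((hne x).filter_mono (nhdsWithin_mono x fun y (hy : y < x) => hy.ne))
    obtain ⟨z, hz⟩ := Set.nonempty_Ioo.2 (show a < x from ha)
    refine ⟨N z, ?_⟩
    filter_upwards [Ioo_mem_nhdsLT ha] with y hy using hconst isPreconnected_Ioo h y hy z hz
  have hr : ∀ x, ∃ c, ∀ᶠ y in 𝓝[>] x, N y = c := by
    intro x
    obtain ⟨a, ha, h⟩ := (mem_nhdsGT_iff_exists_Ioo_subset).1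
      ((hne x).filter_mono (nhdsWithin_mono x fun y (hy : x < y) => hy.ne'))
    obtain ⟨z, hz⟩ := Set.nonempty_Ioo.2 (show x < a from ha)
    refine ⟨N z, ?_⟩
    filter_upwards [Ioo_mem_nhdsGT ha] with y hy using hconst isPreconnected_Ioo h y hy z hz
  choose Nl hNl using hl
  choose Nr hNr using hr
  have hNper : Function.Periodic N (2 * Real.pi) := by
    intro k
    simp only [hN, levelsAbove, fun j => hper j k]
  have hNlper : Function.Periodic Nl (2 * Real.pi) := by
    intro x
    have h1 : Tendsto (fun y => y + 2 * Real.pi) (𝓝[<] x) (𝓝[<] (x + 2 * Real.pi)) := by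
      refine tendsto_nhdsWithin_iff.2 ⟨?_, ?_⟩
      · exact ((continuous_id.add continuous_const).tendsto x).mono_left nhdsWithin_le_nhds
      · filter_upwards [self_mem_nhdsWithin] with y hy
        exact add_lt_add_left (show y < x from hy) _
    obtain ⟨y, hy1, hy2⟩ := ((h1.eventually (hNl (x + 2 * Real.pi))).and (hNl x)).exists
    rw [← hy1, ← hy2, hNper]
  have hzero : ∀ x, Nr x - Nl x ≠ 0 → g x = 0 := by
    intro x hx
    by_contra h0
    obtain ⟨y, hy1, hy2⟩ := ((hNl x).and ((hreg x h0).filter_mono nhdsWithin_le_nhds)).exists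
    obtain ⟨z, hz1, hz2⟩ := ((hNr x).and ((hreg x h0).filter_mono nhdsWithin_le_nhds)).exists
    apply hx
    rw [← hy1, ← hz1, hy2, hz2, sub_self]
  have hfin : {k₀ ∈ Set.Ico 0 (2 * Real.pi) | Nr k₀ - Nl k₀ ≠ 0}.Finite :=
    (finite_zeros hg hg0).subset fun x hx => ⟨hx.1, hzero x hx.2⟩
  refine ⟨fun x => Nr x - Nl x, fun k₀ => ?_, hfin, ?_⟩
  · filter_upwards [eventually_levelCount_eq hε (E := E) (hS k₀)] with δ hδ
    have h1 : ∀ᶠ k in 𝓝[>] k₀, (levelCount (S k) E (E + δ) : ℤ) = Nr k₀ - N k₀ := by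
      filter_upwards [hδ.filter_mono (nhdsWithin_mono k₀ fun y (hy : k₀ < y) => hy.ne'), hNr k₀]
        with k hk hk'
      rw [hk, ← hk']
    have h2 : ∀ᶠ k in 𝓝[<] k₀, (levelCount (S k) E (E + δ) : ℤ) = Nl k₀ - N k₀ := by
      filter_upwards [hδ.filter_mono (nhdsWithin_mono k₀ fun y (hy : y < k₀) => hy.ne), hNl k₀]
        with k hk hk'
      rw [hk, ← hk']
    filter_upwards [h1] with k hk
    filter_upwards [h2] with k' hk'
    rw [hk, hk']
    ring
  · have h1 := sum_jumps_eq_zero Real.two_pi_pos hNl hNr hNlper hfin.toFinset (by simp)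
    rw [← h1]
    refine finsum_mem_eq_sum_of_inter_support_eq _ ?_
    ext x
    simp

end Flow

/-! ### Bands of the bulk entanglement spectrum -/

section Energy

theorem continuous_entanglementEnergy : Continuous entanglementEnergy := by
  refine ENNReal.continuous_log.comp ?_
  rw [continuous_iff_continuousAt]
  intro l
  have h1 : Continuous fun l : ℝ => ENNReal.ofReal (1 + l) :=
    ENNReal.continuous_ofReal.comp (continuous_const.add continuous_id)
  have h2 : Continuous fun l : ℝ => ENNReal.ofReal (1 - l) :=
    ENNReal.continuous_ofReal.comp (continuous_const.sub continuous_id)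
  -- The quotient is never `0 / 0`, since `1 + l` and `1 - l` are not both nonpositive.
  refine ENNReal.Tendsto.div h1.continuousAt ?_ h2.continuousAt (Or.inl ENNReal.ofReal_ne_top)
  by_cases h : 1 + l ≤ 0
  · exact Or.inr (by rw [Ne, ENNReal.ofReal_eq_zero]; linarith)
  · exact Or.inl (by rwa [Ne, ENNReal.ofReal_eq_zero])

theorem strictMonoOn_entanglementEnergy :
    StrictMonoOn entanglementEnergy (Set.Icc (-1) 1) := by
  intro a ha b hb hab
  refine ENNReal.log_strictMono ?_
  have ha1 : 0 < 1 - a := by linarith [hb.2]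
  rcases hb.2.lt_or_eq with hb1 | rfl
  · have h1 : 0 < 1 - b := by linarith
    rw [← ENNReal.ofReal_div_of_pos ha1, ← ENNReal.ofReal_div_of_pos h1]
    refine (ENNReal.ofReal_lt_ofReal_iff (div_pos (by linarith [ha.1]) h1)).2 ?_
    rw [div_lt_div_iff₀ ha1 h1]
    nlinarith
  · rw [sub_self, ENNReal.ofReal_zero, ENNReal.div_zero (by norm_num)]
    rw [← ENNReal.ofReal_div_of_pos ha1]
    exact ENNReal.ofReal_lt_top

theorem exists_entanglementEnergy_eq (E : ℝ) :
    ∃ t ∈ Set.Icc (-1 : ℝ) 1, entanglementEnergy t = E := by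
  have hE := Real.exp_pos E
  refine ⟨(Real.exp E - 1) / (Real.exp E + 1), ⟨?_, ?_⟩, ?_⟩
  · rw [le_div_iff₀ (by linarith)]; linarith
  · rw [div_le_one (by linarith)]; linarith
  · have h1 : 0 < 1 - (Real.exp E - 1) / (Real.exp E + 1) := by
      rw [sub_pos, div_lt_one (by linarith)]; linarith
    rw [entanglementEnergy, ← ENNReal.ofReal_div_of_pos h1]
    have h2 : (1 + (Real.exp E - 1) / (Real.exp E + 1)) /
        (1 - (Real.exp E - 1) / (Real.exp E + 1)) = Real.exp E := by
      field_simp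
      ring
    rw [h2, ENNReal.log_ofReal_of_pos hE, Real.log_exp]

end Energy

section Bands

open Matrix

variable {n : ℕ}

theorem charpoly_toEuclideanCLM {ι : Type} [Fintype ι] [DecidableEq ι] (M : Matrix ι ι ℂ) :
    (toEuclideanCLM (𝕜 := ℂ) M).toLinearMap.charpoly = M.charpoly := by
  rw [coe_toEuclideanCLM_eq_toEuclideanLin]
  exact charpoly_toLin M (PiLp.basisFun 2 ℂ ι)

theorem bulkEntanglementSpectrum_eq (N₁ N₂ : GaussianChannel (CellMode n)) (k : ℝ) :
    bulkEntanglementSpectrum N₁ N₂ k =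
      (LinearMap.charpoly (steadyOn (toEuclideanCLM (𝕜 := ℂ) (periodB N₁ N₂ k))
        (toEuclideanCLM (𝕜 := ℂ) (periodA N₁ N₂ k))).toLinearMap).roots.map
          fun z => entanglementEnergy z.im := by
  rw [bulkEntanglementSpectrum, steadyEigenvalues, steadyCorrelation_eq]
  rfl

/-- The bulk entanglement spectrum consists of finitely many continuous periodic bands of
eigenvalues, each of which is generically met a constant number of times by every level. -/
theorem exists_bands (N₁ N₂ : GaussianChannel (CellMode n)) :
    ∃ (D : ℕ) (l : Fin D → ℝ → ℝ), (∀ j, Continuous (l j)) ∧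
      (∀ j, Function.Periodic (l j) (2 * Real.pi)) ∧ (∀ j k, l j k ∈ Set.Icc (-1 : ℝ) 1) ∧
      (∃ q ∈ analyticPeriodic, q ≠ 0 ∧ ∀ k, q k ≠ 0 → bulkEntanglementSpectrum N₁ N₂ k =
        Finset.univ.val.map fun j => entanglementEnergy (l j k)) ∧
      ∀ t ∈ Set.Icc (-1 : ℝ) 1, ∃ g ∈ analyticPeriodic, g ≠ 0 ∧ ∃ m : ℕ, ∀ k, g k ≠ 0 →
        (Finset.univ.filter fun j => l j k = t).card = m := by
  classical
  obtain ⟨q, hq, hq0, M, hM, hMq⟩ := exists_analytic_shiftedSteady N₁ N₂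
  have hpair := isChannelPair_period N₁ N₂
  have hherm : ∀ k, (M k).IsHermitian := by
    refine eq_of_eq_off_zeros hM.continuous.matrix_conjTranspose hM.continuous hq hq0 fun k hk => ?_
    refine EquivLike.injective (toEuclideanCLM (𝕜 := ℂ)) ?_
    rw [← star_eq_conjTranspose, map_star, hMq k hk]
    exact (hpair k).isSelfAdjoint_shiftedSteady
  set μ : Fin (Fintype.card (CellMode n)) → ℝ → ℝ := fun j k => (hherm k).eigenvalues₀ j with hμ
  have hμc : ∀ j, Continuous (μ j) := continuous_eigenvalues₀ hM.continuous hherm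
  have hμp : ∀ j, Function.Periodic (μ j) (2 * Real.pi) := by
    intro j k
    have : ∀ {X Y : Matrix (CellMode n) (CellMode n) ℂ} (hX : X.IsHermitian) (hY : Y.IsHermitian),
        X = Y → hX.eigenvalues₀ j = hY.eigenvalues₀ j := by
      rintro X Y hX hY rfl
      rfl
    exact this _ _ (hM.periodic k)
  have hroots : ∀ k, (M k).charpoly.roots = Finset.univ.val.map fun j => (μ j k : ℂ) := fun k =>
    (hherm k).roots_charpoly_eq_eigenvalues₀
  have hμmem : ∀ j k, μ j k ∈ ({0} ∪ Set.Icc 2 4 : Set ℝ) := by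
    intro j
    refine mem_of_mem_off_zeros (hμc j) (isClosed_singleton.union isClosed_Icc) hq hq0
      fun k hk => ?_
    have h1 : (μ j k : ℂ) ∈ (M k).charpoly.roots := by
      rw [hroots]
      exact Multiset.mem_map_of_mem _ (Finset.mem_univ_val j)
    rw [← charpoly_toEuclideanCLM, hMq k hk, (hpair k).roots_charpoly_shiftedSteady,
      Multiset.mem_add] at h1
    rcases h1 with h1 | h1
    · obtain ⟨i, -, hi⟩ := Multiset.mem_map.1 h1
      have hi' : 3 + (hpair k).levels i = μ j k := by exact_mod_cast hi
      have := (hpair k).levels_mem i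
      exact Or.inr ⟨by linarith [this.1], by linarith [this.2]⟩
    · exact Or.inl (by exact_mod_cast Multiset.eq_of_mem_replicate h1)
  -- No eigenvalue passes through `1`, so those of the dissipative modes have the same
  -- indices at all momenta.
  have hJ : ∀ j k, 1 ≤ μ j k ↔ 1 ≤ μ j 0 := by
    have hne : ∀ j k, μ j k ≠ 1 := by
      intro j k h
      rcases h ▸ hμmem j k with h | h
      · norm_num at h
      · norm_num at h
    have hstep : ∀ j k k', 1 ≤ μ j k → 1 ≤ μ j k' := by
      intro j k k' h
      by_contra h'
      obtain ⟨x, hx⟩ := mem_range_of_exists_le_of_exists_ge (hμc j) ⟨k', (not_le.1 h').le⟩ ⟨k, h⟩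
      exact hne j x hx
    exact fun j k => ⟨hstep j k 0, hstep j 0 k⟩
  set J : Finset (Fin (Fintype.card (CellMode n))) :=
    Finset.univ.filter fun j => 1 ≤ μ j 0 with hJdef
  set e : Fin J.card ≃ J := J.equivFin.symm
  have hJmem : ∀ j ∈ J, ∀ k, μ j k ∈ Set.Icc (2 : ℝ) 4 := by
    intro j hj k
    have h1 : 1 ≤ μ j k := (hJ j k).2 (Finset.mem_filter.1 hj).2
    rcases hμmem j k with h | h
    · rw [Set.mem_singleton_iff.1 h] at h1
      norm_num at h1
    · exact h
  have hsum : ∀ {β : Type} (f : Fin (Fintype.card (CellMode n)) → β),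
      (Finset.univ.val.map fun i => f (e i)) = J.val.map f := by
    intro β f
    have h1 : (Finset.univ.val.map fun i => f (e i)) =
        (Finset.univ.val.map e).map fun x : J => f x := by rw [Multiset.map_map]; rfl
    rw [h1, Multiset.map_univ_val_equiv, ← Finset.attach_eq_univ]
    exact Multiset.attach_map_val' J.val f
  refine ⟨J.card, fun i k => μ (e i) k - 3, fun i => (hμc _).sub continuous_const,
    fun i k => by simp only [hμp (e i) k], fun i k => ?_, ⟨q, hq, hq0, fun k hk => ?_⟩,
    fun t ht => ?_⟩
  · have := hJmem (e i) (e i).2 k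
    exact ⟨by linarith [this.1], by linarith [this.2]⟩
  · rw [bulkEntanglementSpectrum_eq, (hpair k).map_levels_eq, ← hMq k hk, charpoly_toEuclideanCLM,
      hroots, Multiset.map_map, Multiset.filter_map, Multiset.map_map,
      hsum fun j => entanglementEnergy (μ j k - 3)]
    have h2 : Multiset.filter ((fun x : ℝ => 1 ≤ x) ∘ Complex.re ∘ fun j => (μ j k : ℂ))
        Finset.univ.val = J.val := by
      rw [hJdef, Finset.filter_val]
      refine Multiset.filter_congr fun j _ => ?_
      simpa using hJ j k
    rw [h2]
    rfl
  · obtain ⟨g, hg, hg0, m, hm⟩ := hM.exists_rootMultiplicity_eq ((3 + t : ℝ) : ℂ)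
    refine ⟨g, hg, hg0, m, fun k hk => ?_⟩
    rw [← hm k hk, ← Polynomial.count_roots, hroots, Multiset.count_map]
    have h1 : (Finset.univ.filter fun i => μ (e i) k - 3 = t).card =
        ((Finset.univ.val.map fun i => μ (e i) k).filter fun x => x = 3 + t).card := by
      rw [Multiset.filter_map, Multiset.card_map, Finset.card_def, Finset.filter_val]
      congr 1
      refine Multiset.filter_congr fun i _ => ?_
      simp only [Function.comp_apply]
      constructor <;> intro h <;> linarith
    rw [h1, hsum fun j => μ j k, Multiset.filter_map, Multiset.card_map, hJdef, Finset.filter_val,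
      Multiset.filter_filter]
    congr 1
    refine Multiset.filter_congr fun j _ => ?_
    simp only [Function.comp_apply, Complex.ofReal_inj]
    constructor
    · exact fun h => h.1.symm
    · exact fun h => ⟨h.symm, (hJ j k).1 (by linarith [ht.1])⟩

theorem periodic_bulkEntanglementSpectrum (N₁ N₂ : GaussianChannel (CellMode n)) :
    Function.Periodic (bulkEntanglementSpectrum N₁ N₂) (2 * Real.pi) := by
  intro k
  rw [bulkEntanglementSpectrum_eq, bulkEntanglementSpectrum_eq,
    (isAnalyticFamily_periodB N₁ N₂).periodic k, (isAnalyticFamily_periodA N₁ N₂).periodic k]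

theorem continuousUpToRemovable_bulkEntanglementSpectrum (N₁ N₂ : GaussianChannel (CellMode n)) :
    ContinuousUpToRemovable (bulkEntanglementSpectrum N₁ N₂) := by
  obtain ⟨D, l, hl, hper, -, ⟨q, hq, hq0, hS⟩, -⟩ := exists_bands N₁ N₂
  refine ⟨periodic_bulkEntanglementSpectrum N₁ N₂, D, fun j k => entanglementEnergy (l j k),
    fun j => continuous_entanglementEnergy.comp (hl j), fun j k => by simp only [hper j k], ?_⟩
  exact (finite_zeros hq hq0).subset fun k hk => ⟨hk.1, by_contra fun h => hk.2 (hS k h)⟩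

theorem isNonChiral_bulkEntanglementSpectrum (N₁ N₂ : GaussianChannel (CellMode n)) :
    IsNonChiral (bulkEntanglementSpectrum N₁ N₂) := by
  obtain ⟨D, l, hl, hper, hmem, ⟨q, hq, hq0, hS⟩, hcount⟩ := exists_bands N₁ N₂
  refine isNonChiral_of_bands (ε := fun j k => entanglementEnergy (l j k))
    (fun j => continuous_entanglementEnergy.comp (hl j)) (fun j k => by simp only [hper j k])
    (fun k₀ => (eventually_ne_zero_of_mem hq hq0 k₀).mono hS) fun E => ?_
  obtain ⟨t, ht, htE⟩ := exists_entanglementEnergy_eq E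
  obtain ⟨g, hg, hg0, m, hm⟩ := hcount t ht
  refine ⟨g, hg, hg0, m, fun k hk => ?_⟩
  rw [← hm k hk]
  congr 1
  refine Finset.filter_congr fun j _ => ?_
  rw [← htE]
  exact strictMonoOn_entanglementEnergy.injOn.eq_iff (hmem j k) ht

end Bands

theorem mainTheorem1 (n : ℕ) (N₁ N₂ : GaussianChannel (CellMode n)) :
    -- The steady-state correlation matrix of the dissipative modes is well defined at every
    -- momentum: it is the long-time limit from every initial state.
    (∀ (k : ℝ) (Γ₀ : Matrix (CellMode n) (CellMode n) ℂ),
      Tendsto (fun t : ℕ =>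
          blockOn (dissipativeSector N₁ N₂ k) ((momentumPeriod N₁ N₂ k)^[t] Γ₀))
        atTop (𝓝 (steadyCorrelation N₁ N₂ k))) ∧
    -- On every finite ring it is the long-time limit of the circuit in each momentum sector.
    (∀ (L : ℕ) [NeZero L] (m : ℤ) (Γ₀ : Matrix (ZMod L × CellMode n) (ZMod L × CellMode n) ℝ),
      Tendsto (fun t : ℕ =>
          blockOn (dissipativeSector N₁ N₂ (2 * Real.pi * m / L))
            (momentumBlock L (2 * Real.pi * m / L) ((ringPeriod L N₁ N₂)^[t] Γ₀)))
        atTop (𝓝 (steadyCorrelation N₁ N₂ (2 * Real.pi * m / L)))) ∧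
    -- Its eigenvalues are of the form `i l` with `-1 ≤ l ≤ 1`.
    (∀ k : ℝ, ∀ z ∈ steadyEigenvalues N₁ N₂ k, z.re = 0 ∧ z.im ∈ Set.Icc (-1 : ℝ) 1) ∧
    -- The bulk entanglement spectrum is continuous up to removable singularities ...
    ContinuousUpToRemovable (bulkEntanglementSpectrum N₁ N₂) ∧
    -- ... and it is non-chiral.
    IsNonChiral (bulkEntanglementSpectrum N₁ N₂) :=
  ⟨tendsto_blockOn_momentumPeriod N₁ N₂,
    fun L _ m Γ₀ => tendsto_blockOn_ringPeriod N₁ N₂ L m Γ₀, steadyEigenvalues_mem N₁ N₂,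
    continuousUpToRemovable_bulkEntanglementSpectrum N₁ N₂,
    isNonChiral_bulkEntanglementSpectrum N₁ N₂⟩
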